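/- Let $F$ be a field. All algebras are finite-dimensional over $F$. A (left) Leibniz algebra $L$ is an algebra satisfying $a(bc)=(ab)c+b(ac)$; it is a Lie algebra if moreover $aa=0$ for all $a$. Ideals are two-sided, and $\mathrm{Leib}(L)$ is the span of all squares $aa$, $a\in L$. $L$ is strongly solvable if $L^2=LL$ is nilpotent; $L$ is supersolvable if it has a chain of ideals $0=L_0\subset L_1\subset\dots\subset L_n=L$ with $\dim L_i=i$; $L$ is minimally non-supersolvable if it is not supersolvable but all its proper subalgebras are; $L$ is $\phi$-free if the largest ideal contained in the intersection of all maximal subalgebras of $L$ is $0$. **Theorem.** Let $L$ be a solvable, $\phi$-free, minimally non-supersolvable Leibniz algebra over $F$. Then $L$ has a unique minimal ideal $A$, $A^2=0$, and: 1. If $L$ is strongly solvable, then $\dim A>1$ and $L=A\dotplus\langle x\rangle$ (vector space direct sum) for some $x\neq 0$ with $xx=0$. 2. If $L$ is not strongly solvable, then $F$ has characteristic $p>0$, $A$ has a basis $\{e_1,\dots,e_p\}$ (indices taken mod $p$), and one of the following holds: (a) $L=A\dotplus\langle x,y\rangle$ with $x,y$ linearly independent, $xe_i=e_{i+1}$,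 $ye_i=(\alpha+i)e_i$ for some $\alpha\in F$, $yx=x=-xy$, $xx=yy=0$, and every $a\in F$ has the form $a=t^p-t$ with $t\in F$; or (b) $L=A\dotplus\langle x,y,z\rangle$ with $x,y,z$ linearly independent, $xe_i=e_{i+1}$, $ye_i=(i+1)e_{i-1}$, $ze_i=e_i$, $yx=z=-xy$, $xz=zx=yz=zy=0$, $xx=yy=zz=0$, and $F$ is perfect when $p=2$. If $L$ is a Lie algebra, the remaining products $av$ with $a\in A$ are determined by antisymmetry, $av=-va$. If $L$ is not a Lie algebra, then in addition $A=\mathrm{Leib}(L)$ and $AL=0$ (that is, $av=0$ for all $a\in A$, $v\in L$). -/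

import Mathlib

/-! Finite-dimensional (left) Leibniz algebras over a field `F` are modelled as `F`-vector spaces
`L` with an `F`-bilinear product (`NonUnitalNonAssocRing L`, `Module F L`, `IsScalarTower F L L`,
`SMulCommClass F L L`) that satisfies `IsLeibniz L`. Their subalgebras are Mathlib's
`NonUnitalSubalgebra F L`. -/

namespace LeibnizAlg

/-- The left Leibniz identity. -/
def IsLeibniz (L : Type*) [NonUnitalNonAssocRing L] : Prop :=
  ∀ a b c : L, a * (b * c) = (a * b) * c + b * (a * c)

/-- A Leibniz algebra is a Lie algebra when its product is alternating (the left Leibniz identity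
is then the Jacobi identity). -/
def IsLie (L : Type*) [NonUnitalNonAssocRing L] : Prop :=
  ∀ a : L, a * a = 0

section

variable (F : Type*) {L : Type*} [Field F] [NonUnitalNonAssocRing L] [Module F L]

/-- A subspace that is a two-sided ideal. -/
def IsIdeal (I : Submodule F L) : Prop :=
  ∀ v : L, ∀ a ∈ I, v * a ∈ I ∧ a * v ∈ I

/-- A minimal (nonzero) ideal. -/
def IsMinimalIdeal (A : Submodule F L) : Prop :=
  IsIdeal F A ∧ A ≠ ⊥ ∧ ∀ B : Submodule F L, IsIdeal F B → B ≤ A → B = ⊥ ∨ B = A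

/-- `A` is the unique minimal ideal. -/
def IsUniqueMinimalIdeal (A : Submodule F L) : Prop :=
  IsMinimalIdeal F A ∧ ∀ B : Submodule F L, IsMinimalIdeal F B → B = A

/-- The product `IJ` of two subspaces: the span of all products `a * b`, `a ∈ I`, `b ∈ J`. -/
def prodSpan (I J : Submodule F L) : Submodule F L :=
  Submodule.span F {v : L | ∃ a ∈ I, ∃ b ∈ J, v = a * b}

/-- The lower central series `S, SS, S(SS), …` of a subspace (in practice a subalgebra) `S`. -/
def lowerCentral (S : Submodule F L) : ℕ → Submodule F L
  | 0 => S
  | n + 1 => prodSpan F S (lowerCentral S n)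

variable (L)

/-- `Leib(L)`, the span of the squares. -/
def leib : Submodule F L :=
  Submodule.span F {v : L | ∃ a : L, v = a * a}

/-- The derived series of `L`. -/
def derived : ℕ → Submodule F L
  | 0 => ⊤
  | n + 1 => prodSpan F (derived n) (derived n)

/-- `L` is solvable. -/
def Solvable : Prop :=
  ∃ n : ℕ, derived F L n = ⊥

/-- `L` is strongly solvable: `L² = LL` is nilpotent. -/
def StronglySolvable : Prop :=
  ∃ n : ℕ, lowerCentral F (prodSpan F (⊤ : Submodule F L) ⊤) n = ⊥

/-- `L` is supersolvable: there is a chain `0 = L₀ ⊂ L₁ ⊂ ⋯ ⊂ Lₙ = L` of ideals of `L` with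
`dim Lᵢ = i`. -/
def Supersolvable : Prop :=
  ∃ (n : ℕ) (c : ℕ → Submodule F L), c 0 = ⊥ ∧ c n = ⊤ ∧
    (∀ i ≤ n, IsIdeal F (c i) ∧ Module.finrank F (c i) = i) ∧
    ∀ i < n, c i ≤ c (i + 1)

/-- `L` is minimally non-supersolvable: `L` is not supersolvable, but every proper subalgebra of
`L` is. -/
def MinimallyNonSupersolvable [IsScalarTower F L L] [SMulCommClass F L L] : Prop :=
  ¬ Supersolvable F L ∧
    ∀ S : NonUnitalSubalgebra F L, S ≠ ⊤ → Supersolvable F S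

/-- The Frattini subalgebra: the intersection of all maximal subalgebras. -/
def frattini [IsScalarTower F L L] [SMulCommClass F L L] : NonUnitalSubalgebra F L :=
  sInf {M : NonUnitalSubalgebra F L | IsCoatom M}

/-- The Frattini ideal: the largest ideal contained in the Frattini subalgebra, that is, the sum
of all ideals contained in it. -/
def frattiniIdeal [IsScalarTower F L L] [SMulCommClass F L L] : Submodule F L :=
  sSup {I : Submodule F L | IsIdeal F I ∧ I ≤ (frattini F L).toSubmodule}

/-- `L` is `φ`-free: its Frattini ideal is zero. -/
def PhiFree [IsScalarTower F L L] [SMulCommClass F L L] : Prop :=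
  frattiniIdeal F L = ⊥

end

section

variable (F : Type*) {L : Type*} [Field F] [NonUnitalNonAssocRing L] [Module F L]

/-- `L = A ∔ ⟨x⟩`, where `A` is abelian of dimension greater than one and `⟨x⟩` is a
one-dimensional abelian subalgebra. -/
def IsCyclicExtension (A : Submodule F L) : Prop :=
  1 < Module.finrank F A ∧ (∀ a ∈ A, ∀ b ∈ A, a * b = 0) ∧
    ∃ x : L, x ≠ 0 ∧ x * x = 0 ∧ IsCompl A (Submodule.span F {x})

/-- `L = A ∔ ⟨x, y⟩`, where the abelian ideal `A` has a basis `eᵢ` indexed by `ℤ/p`,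
`x eᵢ = eᵢ₊₁`, `y eᵢ = (α + i) eᵢ`, `⟨x, y⟩` is the two-dimensional Lie algebra with `y x = x`,
and every element of `F` has the form `t ^ p - t`. The products `a x`, `a y` with `a ∈ A` are not
recorded here: they are given by antisymmetry if `L` is Lie, and by the separate condition `AL = 0`
if it is not. -/
def IsAffineExtension (p : ℕ) (A : Submodule F L) : Prop :=
  ∃ (e : Module.Basis (ZMod p) F A) (x y : L) (α : F),
    LinearIndependent F ![x, y] ∧ IsCompl A (Submodule.span F {x, y}) ∧
    (∀ a ∈ A, ∀ b ∈ A, a * b = 0) ∧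
    (∀ i : ZMod p, x * (e i : L) = (e (i + 1) : L)) ∧
    (∀ i : ZMod p, y * (e i : L) = (α + (i.cast : F)) • (e i : L)) ∧
    y * x = x ∧ x * y = -x ∧ x * x = 0 ∧ y * y = 0 ∧
    ∀ a : F, ∃ t : F, a = t ^ p - t

/-- `L = A ∔ ⟨x, y, z⟩`, where the abelian ideal `A` has a basis `eᵢ` indexed by `ℤ/p`,
`x eᵢ = eᵢ₊₁`, `y eᵢ = (i + 1) eᵢ₋₁`, `z eᵢ = eᵢ`, `⟨x, y, z⟩` is the Heisenberg Lie algebra with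
`y x = z` and `z` central, and `F` is perfect if `p = 2`. The products `a x`, `a y`, `a z` with
`a ∈ A` are not recorded here, as in `IsAffineExtension`. -/
def IsHeisenbergExtension (p : ℕ) (A : Submodule F L) : Prop :=
  ∃ (e : Module.Basis (ZMod p) F A) (x y z : L),
    LinearIndependent F ![x, y, z] ∧ IsCompl A (Submodule.span F {x, y, z}) ∧
    (∀ a ∈ A, ∀ b ∈ A, a * b = 0) ∧
    (∀ i : ZMod p, x * (e i : L) = (e (i + 1) : L)) ∧
    (∀ i : ZMod p, y * (e i : L) = ((i.cast : F) + 1) • (e (i - 1) : L)) ∧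
    (∀ i : ZMod p, z * (e i : L) = (e i : L)) ∧
    y * x = z ∧ x * y = -z ∧ x * z = 0 ∧ z * x = 0 ∧ y * z = 0 ∧ z * y = 0 ∧
    x * x = 0 ∧ y * y = 0 ∧ z * z = 0 ∧
    (p = 2 → PerfectField F)

/-- `L` is one of the algebras of the classification list, with unique minimal ideal `A`. -/
def IsListed (A : Submodule F L) : Prop :=
  IsUniqueMinimalIdeal F A ∧
    (StronglySolvable F L → IsCyclicExtension F A) ∧
    (¬ StronglySolvable F L →
      ∃ p : ℕ, p.Prime ∧ CharP F p ∧ (IsAffineExtension F p A ∨ IsHeisenbergExtension F p A))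

end

end LeibnizAlg

/-! A minimal ideal `A` is abelian by solvability, and `φ`-freeness gives a complementary subalgebra
`M`, which is proper and hence supersolvable. If `dim A = 1`, a flag of `M` would lift to a flag of
`L`; so `dim A > 1`. Two minimal ideals `A ≠ B` are impossible: a flag of ideals growing from `B` in
steps of one dimension first meets `A` in a line, and minimality makes that line `A`.

The complement `M` is Lie. This is clear if `L` is Lie; otherwise `Leib(L)` contains `A` and meets
`M` in zero, so `Leib(L) = A` and squares of `M` lie in `A ∩ M = 0`. In both cases the right action
on `A` is zero or opposite to the left one, and `M` acts on `A` by a critical representation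
(`isCriticalRep_leftRep`): faithful and irreducible by uniqueness and minimality of `A`, with a
common eigenvector for each proper subalgebra `S`, because `A + S` is supersolvable.

The rest is about critical representations. An operator that commutes with the action and has an
eigenvector is scalar, so an abelian `M` is a line. If `M` is nonabelian, `affine_or_heisenberg`
finds in its flag either `yx = x` or `yx = z` with `z` central. The relation `YX - XY = X` or `YX -
XY = 1` forces characteristic `p`; after normalising `X^p = 1`, the vectors `Xⁱu` for a suitable `u`
form the basis. The conditions on `F` come from eigenvectors of `y + cx` and `x + (r - 1)y`.
Finally, `M` is abelian exactly when `L` is strongly solvable. -/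

namespace LeibnizAlg

/-! ### Operators with `YX - XY = X` and characteristic `p`. -/

open Polynomial in
-- Over the prime field the roots of `X ^ p - X` are all the elements; the factorisation is then
-- evaluated in `F`. It produces the Artin–Schreier condition of the affine case.
theorem prod_sub_zmodCast {F : Type*} [Field F] (p : ℕ) [Fact p.Prime] [CharP F p] (s : F) :
    ∏ i : ZMod p, (s - (i.cast : F)) = s ^ p - s := by
  have hp : 1 < p := (Fact.out : p.Prime).one_lt
  have hr : (X ^ p - X : (ZMod p)[X]).roots = Finset.univ.val := by
    have := FiniteField.roots_X_pow_card_sub_X (ZMod p)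
    rwa [ZMod.card] at this
  have hm : (X ^ p - X : (ZMod p)[X]).Monic :=
    monic_X_pow_sub (by rw [degree_X]; exact_mod_cast hp)
  have h := prod_multiset_X_sub_C_of_monic_of_roots_card_eq hm (by
    rw [hr, FiniteField.X_pow_card_sub_X_natDegree_eq _ hp]
    simp [ZMod.card])
  rw [hr] at h
  have h2 := congrArg (eval₂ (ZMod.castHom dvd_rfl F) s) h
  have h3 : (∏ i : ZMod p, (X - C i)).eval₂ (ZMod.castHom dvd_rfl F) s = s ^ p - s := by
    simpa using h2
  rw [eval₂_finsetProd] at h3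
  simpa using h3

section

variable {F V : Type*} [Field F] [AddCommGroup V] [Module F V]

theorem mul_pow_eq_of_commutator_eq {X Y : Module.End F V} (h : Y * X - X * Y = X) (n : ℕ) :
    Y * X ^ n = X ^ n * Y + (n : F) • X ^ n := by
  have h' : Y * X = X * Y + X := by rw [← sub_eq_iff_eq_add', h]
  induction n with
  | zero => simp
  | succ n ih =>
    rw [pow_succ, ← mul_assoc, ih, add_mul, mul_assoc, h', mul_add, ← mul_assoc, smul_mul_assoc]
    push_cast
    rw [add_smul, one_smul]
    abel

theorem hasEigenvector_pow_apply {X Y : Module.End F V} (h : Y * X - X * Y = X)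
    (hX : Function.Injective X) {α : F} {v : V} (hv : v ≠ 0) (hYv : Y v = α • v) (n : ℕ) :
    Y.HasEigenvector (α + n) ((X ^ n) v) := by
  refine ⟨Module.End.mem_eigenspace_iff.2 ?_, ?_⟩
  · have := congrArg (fun T : Module.End F V => T v) (mul_pow_eq_of_commutator_eq h n)
    simp only [Module.End.mul_apply, LinearMap.add_apply, LinearMap.smul_apply, hYv,
      map_smul] at this
    rw [this, add_smul]
  · have : Function.Injective (X ^ n) := by
      rw [Module.End.coe_pow]
      exact hX.iterate n
    exact (map_ne_zero_iff _ this).2 hv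

/-- In characteristic zero the vectors `Xⁿv` would be eigenvectors of `Y` for the distinct values `α
+ n`, infinitely many in a finite-dimensional space. -/
theorem exists_prime_charP_of_commutator_eq [FiniteDimensional F V] {X Y : Module.End F V}
    (h : Y * X - X * Y = X) (hX : Function.Injective X) {α : F} {v : V} (hv : v ≠ 0)
    (hYv : Y v = α • v) : ∃ p : ℕ, p.Prime ∧ CharP F p := by
  obtain ⟨p, hp⟩ := CharP.exists F
  rcases CharP.char_is_prime_or_zero F p with h1 | h1
  · exact ⟨p, h1, hp⟩
  · subst h1
    have := CharP.charP_to_charZero F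
    have hli := Module.End.eigenvectors_linearIndependent' Y (fun n : ℕ => α + n)
      (fun a b hab => by simpa using hab) (fun n => (X ^ n) v)
      (hasEigenvector_pow_apply h hX hv hYv)
    have := hli.finite
    exact (not_finite ℕ).elim

/-- The vectors `Xⁱ v`, indexed by `ℤ/p`. -/
def orbitFamily (p : ℕ) (X : Module.End F V) (v : V) (i : ZMod p) : V := (X ^ i.val) v

theorem pow_apply_eq_orbitFamily {p : ℕ} [NeZero p] {X : Module.End F V} (hXp : X ^ p = 1) (v : V)
    (n : ℕ) : (X ^ n) v = orbitFamily p X v n := by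
  rw [orbitFamily, ZMod.val_natCast, ← pow_mod_orderOf, ← pow_mod_orderOf X (n % p),
    Nat.mod_mod_of_dvd _ (orderOf_dvd_of_pow_eq_one hXp)]

theorem apply_orbitFamily {p : ℕ} [NeZero p] {X : Module.End F V} (hXp : X ^ p = 1) (v : V)
    (i : ZMod p) : X (orbitFamily p X v i) = orbitFamily p X v (i + 1) := by
  have : ((i.val + 1 : ℕ) : ZMod p) = i + 1 := by simp
  rw [← this, ← pow_apply_eq_orbitFamily hXp, pow_succ', Module.End.mul_apply, orbitFamily]

theorem orbitFamily_zero {p : ℕ} [NeZero p] (X : Module.End F V) (v : V) :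
    orbitFamily p X v 0 = v := by
  simp [orbitFamily]

theorem injective_of_pow_eq_one {p : ℕ} (hp : p ≠ 0) {X : Module.End F V} (hXp : X ^ p = 1) :
    Function.Injective X := by
  obtain ⟨n, rfl⟩ := Nat.exists_eq_succ_of_ne_zero hp
  rw [pow_succ] at hXp
  exact Function.LeftInverse.injective (g := X ^ n) fun v =>
    congrArg (fun T : Module.End F V => T v) hXp

theorem hasEigenvector_orbitFamily {p : ℕ} [Fact p.Prime] [CharP F p] {X Y : Module.End F V}
    (h : Y * X - X * Y = X) (hXp : X ^ p = 1) {α : F} {v : V} (hv : v ≠ 0) (hYv : Y v = α • v)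
    (i : ZMod p) : Y.HasEigenvector (α + (i.cast : F)) (orbitFamily p X v i) := by
  have := hasEigenvector_pow_apply h
    (injective_of_pow_eq_one (Fact.out : p.Prime).ne_zero hXp) hv hYv i.val
  rwa [ZMod.natCast_val] at this

theorem linearIndependent_orbitFamily {p : ℕ} [Fact p.Prime] [CharP F p] {X Y : Module.End F V}
    (h : Y * X - X * Y = X) (hXp : X ^ p = 1) {α : F} {v : V} (hv : v ≠ 0) (hYv : Y v = α • v) :
    LinearIndependent F (orbitFamily p X v) := by
  refine Module.End.eigenvectors_linearIndependent' Y _ (fun i j hij => ?_) _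
    (hasEigenvector_orbitFamily h hXp hv hYv)
  have hij' : (ZMod.castHom dvd_rfl F i : F) = ZMod.castHom dvd_rfl F j := by simpa using hij
  exact (ZMod.castHom (dvd_refl p) F).injective hij'

end

/-! ### Critical representations. -/

/-- A faithful irreducible representation `ρ` of a Lie algebra `M` that is not one-dimensional,
although every proper subalgebra of `M` has a common eigenvector. -/
structure IsCriticalRep {F M V : Type*} [Field F] [NonUnitalNonAssocRing M] [Module F M]
    [AddCommGroup V] [Module F V] (ρ : M →ₗ[F] Module.End F V) : Prop where
  alt : ∀ x : M, x * x = 0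
  map_mul : ∀ x y : M, ρ (x * y) = ρ x * ρ y - ρ y * ρ x
  inj : Function.Injective ρ
  irred : ∀ W : Submodule F V, (∀ m : M, ∀ w ∈ W, ρ m w ∈ W) → W = ⊥ ∨ W = ⊤
  eigen : ∀ S : Submodule F M, (∀ x ∈ S, ∀ y ∈ S, x * y ∈ S) → S ≠ ⊤ →
    ∃ a : V, a ≠ 0 ∧ ∀ s ∈ S, ∃ c : F, ρ s a = c • a
  one_lt_finrank : 1 < Module.finrank F V

namespace IsCriticalRep

variable {F M V : Type*} [Field F] [NonUnitalNonAssocRing M] [Module F M]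
  [AddCommGroup V] [Module F V] {ρ : M →ₗ[F] Module.End F V}

theorem mul_anticomm (h : IsCriticalRep ρ) (x y : M) : x * y = -(y * x) := by
  have := h.alt (x + y)
  rw [add_mul, mul_add, mul_add, h.alt, h.alt, zero_add, add_zero] at this
  exact eq_neg_of_add_eq_zero_left this

theorem eq_top_of_mem (h : IsCriticalRep ρ) {W : Submodule F V}
    (hW : ∀ m : M, ∀ w ∈ W, ρ m w ∈ W) {v : V} (hv : v ≠ 0) (hvW : v ∈ W) : W = ⊤ :=
  (h.irred W hW).resolve_left fun hb => hv (by simpa [hb] using hvW)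

theorem not_forall_scalar (h : IsCriticalRep ρ) : ¬ ∀ m : M, ∃ c : F, ρ m = c • 1 := by
  intro hs
  have : FiniteDimensional F V :=
    Module.finite_of_finrank_pos (zero_lt_one.trans h.one_lt_finrank)
  have : Nontrivial V := Module.nontrivial_of_finrank_pos (zero_lt_one.trans h.one_lt_finrank)
  obtain ⟨v, hv⟩ := exists_ne (0 : V)
  have hW : Submodule.span F {v} = ⊤ := h.eq_top_of_mem (fun m w hw => by
    obtain ⟨c, hc⟩ := hs m
    rw [hc]
    exact Submodule.smul_mem _ c hw) hv (Submodule.mem_span_singleton_self v)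
  have := finrank_span_singleton (K := F) hv
  rw [hW, finrank_top] at this
  exact absurd this h.one_lt_finrank.ne'

/-- Schur's lemma for an operator with a known eigenvector: its eigenspace is invariant. -/
theorem eq_smul_one_of_commute (h : IsCriticalRep ρ) {T : Module.End F V}
    (hT : ∀ m, T * ρ m = ρ m * T) {c : F} {v : V} (hv : v ≠ 0) (hTv : T v = c • v) :
    T = c • 1 := by
  have := h.eq_top_of_mem (W := T.eigenspace c) (fun m w hw => by
    rw [Module.End.mem_eigenspace_iff] at hw ⊢
    have := congrArg (fun T : Module.End F V => T w) (hT m)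
    simp only [Module.End.mul_apply] at this
    rw [this, hw, map_smul]) hv (Module.End.mem_eigenspace_iff.2 hTv)
  ext w
  have hw : w ∈ T.eigenspace c := by rw [this]; trivial
  simpa using Module.End.mem_eigenspace_iff.1 hw

theorem exists_eigenvector (h : IsCriticalRep ρ) {x : M} (hx : Submodule.span F {x} ≠ ⊤)
    [IsScalarTower F M M] [SMulCommClass F M M] :
    ∃ (a : V) (c : F), a ≠ 0 ∧ ρ x a = c • a := by
  obtain ⟨a, ha, hS⟩ := h.eigen (Submodule.span F {x}) (fun u hu w hw => by
    obtain ⟨b, rfl⟩ := Submodule.mem_span_singleton.1 hu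
    obtain ⟨c, rfl⟩ := Submodule.mem_span_singleton.1 hw
    rw [smul_mul_assoc, mul_smul_comm, h.alt, smul_zero, smul_zero]
    exact Submodule.zero_mem _) hx
  obtain ⟨c, hc⟩ := hS x (Submodule.mem_span_singleton_self x)
  exact ⟨a, c, ha, hc⟩

/-- Scalars commute, so commutators kill a common eigenvector. -/
theorem exists_mul_apply_eq_zero (h : IsCriticalRep ρ) {S : Submodule F M}
    (hS : ∀ x ∈ S, ∀ y ∈ S, x * y ∈ S) (hS' : S ≠ ⊤) :
    ∃ a : V, a ≠ 0 ∧ ∀ x ∈ S, ∀ y ∈ S, ρ (x * y) a = 0 := by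
  obtain ⟨a, ha, hc⟩ := h.eigen S hS hS'
  refine ⟨a, ha, fun x hx y hy => ?_⟩
  obtain ⟨b, hb⟩ := hc x hx
  obtain ⟨c, hc⟩ := hc y hy
  simp [h.map_mul, hb, hc, smul_smul, mul_comm]

/-- A product of elements that spans an ideal acts injectively. -/
theorem eq_zero_of_apply_eq_zero (h : IsCriticalRep ρ) {x : M} (hx : x ≠ 0)
    (hI : ∀ m : M, ∃ c : F, m * x = c • x) {a : V} (ha : ρ x a = 0) : a = 0 := by
  by_contra ha0
  have := h.eq_top_of_mem (W := LinearMap.ker (ρ x)) (fun m w hw => by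
    rw [LinearMap.mem_ker] at hw ⊢
    obtain ⟨c, hc⟩ := hI m
    have h1 := congrArg (fun T : Module.End F V => T w) (h.map_mul m x)
    simp only [hc, map_smul, LinearMap.smul_apply, hw, smul_zero, LinearMap.sub_apply,
      Module.End.mul_apply, map_zero, zero_sub] at h1
    exact neg_eq_zero.1 h1.symm) ha0 ha
  exact hx (h.inj (by rw [LinearMap.ker_eq_top.1 this, map_zero]))

variable [IsScalarTower F M M] [SMulCommClass F M M]

/-- If no line fills `M`, every element has an eigenvector and commutes with the action, hence is
scalar; irreducibility then forces dimension one. -/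
theorem exists_span_singleton_eq_top (h : IsCriticalRep ρ) (hab : ∀ x y : M, x * y = 0) :
    ∃ x : M, x ≠ 0 ∧ Submodule.span F {x} = ⊤ := by
  by_contra! hne
  refine h.not_forall_scalar fun m => ?_
  have hm : Submodule.span F {m} ≠ ⊤ := by
    rcases eq_or_ne m 0 with rfl | hm
    · intro htop
      refine h.not_forall_scalar fun m => ⟨0, ?_⟩
      have : m ∈ Submodule.span F {(0 : M)} := htop ▸ Submodule.mem_top
      rw [Submodule.span_zero_singleton, Submodule.mem_bot] at this
      simp [this]
    · exact hne m hm
  obtain ⟨a, c, ha, hc⟩ := h.exists_eigenvector hm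
  exact ⟨c, h.eq_smul_one_of_commute (fun x => by
    have := h.map_mul m x
    rw [hab, map_zero] at this
    exact (sub_eq_zero.1 this.symm)) ha hc⟩

theorem span_singleton_ne_top (h : IsCriticalRep ρ) (hab : ¬ ∀ x y : M, x * y = 0) (x : M) :
    Submodule.span F {x} ≠ ⊤ := by
  intro htop
  refine hab fun u w => ?_
  have hu : u ∈ Submodule.span F {x} := htop ▸ Submodule.mem_top
  have hw : w ∈ Submodule.span F {x} := htop ▸ Submodule.mem_top
  obtain ⟨b, rfl⟩ := Submodule.mem_span_singleton.1 hu
  obtain ⟨c, rfl⟩ := Submodule.mem_span_singleton.1 hw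
  rw [smul_mul_assoc, mul_smul_comm, h.alt, smul_zero, smul_zero]

/-- A nonzero central element acts as a nonzero scalar. -/
theorem exists_scalar_of_central (h : IsCriticalRep ρ) (hab : ¬ ∀ x y : M, x * y = 0) {z : M}
    (hz : z ≠ 0) (hc : ∀ m, m * z = 0) : ∃ c : F, c ≠ 0 ∧ ρ z = c • 1 := by
  obtain ⟨a, c, ha, hac⟩ := h.exists_eigenvector (h.span_singleton_ne_top hab z)
  have hs := h.eq_smul_one_of_commute (fun x => by
    have := h.map_mul x z
    rw [hc, map_zero] at this
    exact (sub_eq_zero.1 this.symm).symm) ha hac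
  refine ⟨c, fun h0 => hz (h.inj ?_), hs⟩
  rw [hs, h0, zero_smul, map_zero]

/-- If the span were proper, `x = yx` would kill a common eigenvector; but `x` spans an ideal, so it
acts injectively. -/
theorem span_pair_eq_top (h : IsCriticalRep ρ) {x y : M} (hx : x ≠ 0)
    (hI : ∀ m : M, ∃ c : F, m * x = c • x) (hyx : y * x = x) : Submodule.span F {x, y} = ⊤ := by
  by_contra hne
  obtain ⟨a, ha, h0⟩ := h.exists_mul_apply_eq_zero (S := Submodule.span F {x, y})
    (fun u hu w hw => by
      obtain ⟨a, b, rfl⟩ := Submodule.mem_span_pair.1 hu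
      obtain ⟨c, d, rfl⟩ := Submodule.mem_span_pair.1 hw
      refine Submodule.mem_span_pair.2 ⟨b * c - a * d, 0, ?_⟩
      simp only [add_mul, mul_add, smul_mul_assoc, mul_smul_comm, h.alt, hyx,
        h.mul_anticomm x y]
      module) hne
  refine ha (h.eq_zero_of_apply_eq_zero hx hI (a := a) ?_)
  have := h0 y (Submodule.subset_span (by simp)) x (Submodule.subset_span (by simp))
  rwa [hyx] at this

theorem span_triple_eq_top (h : IsCriticalRep ρ) {x y z : M}
    (hz : z ≠ 0) (hc : ∀ m, m * z = 0) (hyx : y * x = z) : Submodule.span F {x, y, z} = ⊤ := by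
  by_contra hne
  have hc' : ∀ m, z * m = 0 := fun m => by rw [h.mul_anticomm, hc, neg_zero]
  obtain ⟨a, ha, h0⟩ := h.exists_mul_apply_eq_zero (S := Submodule.span F {x, y, z})
    (fun u hu w hw => by
      obtain ⟨a, b, e, rfl⟩ := Submodule.mem_span_triple.1 hu
      obtain ⟨c, d, f, rfl⟩ := Submodule.mem_span_triple.1 hw
      refine Submodule.mem_span_triple.2 ⟨0, 0, b * c - a * d, ?_⟩
      simp only [add_mul, mul_add, smul_mul_assoc, mul_smul_comm, h.alt, hyx, hc, hc',
        h.mul_anticomm x y]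
      module) hne
  refine ha (h.eq_zero_of_apply_eq_zero hz (fun m => ⟨0, by simp [hc]⟩) (a := a) ?_)
  have := h0 y (Submodule.subset_span (by simp)) x (Submodule.subset_span (by simp))
  rwa [hyx] at this

end IsCriticalRep
end LeibnizAlg

/-! ### The nonabelian critical representations. -/

namespace LeibnizAlg

theorem exists_eq_sup_span_singleton {F M : Type*} [Field F] [AddCommGroup M] [Module F M]
    [FiniteDimensional F M] {U W : Submodule F M} (hle : U ≤ W)
    (hd : Module.finrank F W = Module.finrank F U + 1) :
    ∃ u : M, u ∉ U ∧ W = U ⊔ Submodule.span F {u} := by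
  have hlt : U < W := lt_of_le_of_ne hle fun h => by rw [h] at hd; omega
  obtain ⟨u, huW, huU⟩ := SetLike.exists_of_lt hlt
  refine ⟨u, huU, (Submodule.eq_of_le_of_finrank_le (sup_le hle ?_) ?_).symm⟩
  · rwa [Submodule.span_singleton_le_iff_mem]
  · have : U < U ⊔ Submodule.span F {u} := lt_of_le_of_ne le_sup_left fun h =>
      huU (h ▸ Submodule.mem_sup_right (Submodule.mem_span_singleton_self u))
    have := Submodule.finrank_lt_finrank_of_lt this
    omega

namespace IsCriticalRep

variable {F M V : Type*} [Field F] [NonUnitalNonAssocRing M] [Module F M]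
  [AddCommGroup V] [Module F V] {ρ : M →ₗ[F] Module.End F V}

theorem commute_of_span_eq_top {s : Set M} (hs : Submodule.span F s = ⊤) {T : Module.End F V}
    (hT : ∀ m ∈ s, T * ρ m = ρ m * T) (m : M) : T * ρ m = ρ m * T := by
  have hm : m ∈ Submodule.span F s := hs ▸ Submodule.mem_top
  induction hm using Submodule.span_induction with
  | mem x hx => exact hT x hx
  | zero => simp
  | add x y _ _ hx hy => rw [map_add, mul_add, add_mul, hx, hy]
  | smul a x _ hx => rw [map_smul, mul_smul_comm, smul_mul_assoc, hx]

theorem span_range_eq_top (h : IsCriticalRep ρ) {s : Set M} (hs : Submodule.span F s = ⊤)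
    {ι : Type*} {e : ι → V} {i : ι} (hi : e i ≠ 0)
    (he : ∀ m ∈ s, ∀ j, ρ m (e j) ∈ Submodule.span F (Set.range e)) :
    Submodule.span F (Set.range e) = ⊤ := by
  refine h.eq_top_of_mem (fun m w hw => ?_) hi (Submodule.subset_span ⟨i, rfl⟩)
  have hm : m ∈ Submodule.span F s := hs ▸ Submodule.mem_top
  induction hm using Submodule.span_induction with
  | mem x hx =>
    have : Submodule.span F (Set.range e) ≤ (Submodule.span F (Set.range e)).comap (ρ x) :=
      Submodule.span_le.2 (by rintro _ ⟨j, rfl⟩; exact he x hx j)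
    exact this hw
  | zero => simp
  | add x y _ _ hx hy => rw [map_add]; exact Submodule.add_mem _ hx hy
  | smul a x _ hx => rw [map_smul]; exact Submodule.smul_mem _ _ hx

variable [IsScalarTower F M M] [SMulCommClass F M M]

/-- A supersolvable nonabelian Lie algebra with a critical representation is the two-dimensional
nonabelian algebra or the Heisenberg algebra. -/
theorem affine_or_heisenberg [FiniteDimensional F M] (h : IsCriticalRep ρ)
    (hab : ¬ ∀ x y : M, x * y = 0) (hs : Supersolvable F M) :
    (∃ x y : M, x ≠ 0 ∧ y * x = x ∧ Submodule.span F {x, y} = ⊤) ∨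
    ∃ x y z : M, z ≠ 0 ∧ y * x = z ∧ (∀ m, m * z = 0) ∧ ρ z = 1 := by
  obtain ⟨n, c, h0, hn, hc, hle⟩ := hs
  have hn2 : 2 ≤ n := by
    by_contra hlt
    have hd : Module.finrank F M ≤ 1 := by
      have := (hc n le_rfl).2
      rw [hn, finrank_top] at this
      omega
    obtain ⟨v, hv⟩ := finrank_le_one_iff.1 hd
    refine h.span_singleton_ne_top hab v (eq_top_iff.2 fun w _ => ?_)
    exact Submodule.mem_span_singleton.2 (hv w)
  have hstep : ∀ i < n, ∃ u : M, u ∉ c i ∧ c (i + 1) = c i ⊔ Submodule.span F {u} := fun i hi =>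
    exists_eq_sup_span_singleton (hle i hi) (by rw [(hc _ hi).2, (hc i hi.le).2])
  by_cases hI : ∃ x : M, x ≠ 0 ∧ (∀ m : M, ∃ a : F, m * x = a • x) ∧ ∃ m, m * x ≠ 0
  · left
    obtain ⟨x, hx, hxI, m, hm⟩ := hI
    obtain ⟨a, ha⟩ := hxI m
    have ha0 : a ≠ 0 := by rintro rfl; exact hm (by rw [ha, zero_smul])
    have hyx : (a⁻¹ • m) * x = x := by rw [smul_mul_assoc, ha, inv_smul_smul₀ ha0]
    exact ⟨x, a⁻¹ • m, hx, hyx, h.span_pair_eq_top hx hxI hyx⟩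
  · right
    push Not at hI
    obtain ⟨z₀, hz₀, hc1⟩ := hstep 0 (by omega)
    -- In this branch every element spanning an ideal is central. So `z₀` is central, acts as a
    -- nonzero scalar, and is rescaled to `z` acting as the identity; `x` spans the second flag step
    -- modulo `z`.
    obtain ⟨x, hx, hc2⟩ := hstep 1 (by omega)
    rw [h0, bot_sup_eq, zero_add] at hc1
    rw [h0, Submodule.mem_bot] at hz₀
    rw [hc1] at hx hc2
    have hz₀c : ∀ m, m * z₀ = 0 := hI z₀ hz₀ fun m => by
      have : m * z₀ ∈ c 1 := ((hc 1 (by omega)).1 m z₀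
        (hc1 ▸ Submodule.mem_span_singleton_self z₀)).1
      rw [hc1] at this
      obtain ⟨a, ha⟩ := Submodule.mem_span_singleton.1 this
      exact ⟨a, ha.symm⟩
    obtain ⟨b, hb, hρz₀⟩ := h.exists_scalar_of_central hab hz₀ hz₀c
    obtain ⟨z, hzdef⟩ : ∃ z, z = b⁻¹ • z₀ := ⟨_, rfl⟩
    have hz : z ≠ 0 := hzdef ▸ smul_ne_zero (inv_ne_zero hb) hz₀
    have hzc : ∀ m, m * z = 0 := fun m => by rw [hzdef, mul_smul_comm, hz₀c, smul_zero]
    have hρz : ρ z = 1 := by rw [hzdef, map_smul, hρz₀, inv_smul_smul₀ hb]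
    have hxz : ∀ a : F, x ≠ a • z := fun a hxa => hx (Submodule.mem_span_singleton.2
      ⟨a * b⁻¹, by rw [hxa, hzdef, mul_smul]⟩)
    have hmx : ∀ m, ∃ a d : F, m * x = a • x + d • z := fun m => by
      have : m * x ∈ c 2 := ((hc 2 hn2).1 m x (by
        rw [hc2]
        exact Submodule.mem_sup_right (Submodule.mem_span_singleton_self x))).1
      rw [hc2] at this
      obtain ⟨u, hu, w, hw, huw⟩ := Submodule.mem_sup.1 this
      obtain ⟨d, rfl⟩ := Submodule.mem_span_singleton.1 hu
      obtain ⟨a, rfl⟩ := Submodule.mem_span_singleton.1 hw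
      refine ⟨a, d * b, ?_⟩
      rw [← huw, hzdef, smul_smul, mul_assoc, mul_inv_cancel₀ hb, mul_one, add_comm]
    -- If `a ≠ 0`, then `y = a⁻¹m` fixes `x' = x + a⁻¹dz`. As `x'` is not central, it spans no
    -- ideal, so some `w` moves it by a nonzero multiple of `z` modulo `x'`. Then `x'`, `w - ey`,
    -- `z` span `M`, so `yx'` is a multiple of `z`, contradicting `yx' = x'`.
    have hmx0 : ∀ m (a d : F), m * x = a • x + d • z → a = 0 := by
      intro m a d hm
      by_contra ha
      obtain ⟨y, hy⟩ : ∃ y, y = a⁻¹ • m := ⟨_, rfl⟩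
      obtain ⟨x', hx'⟩ : ∃ x', x' = x + (a⁻¹ * d) • z := ⟨_, rfl⟩
      have hx'z : ∀ e : F, x' ≠ e • z := fun e he => hxz (e - a⁻¹ * d) (by
        rw [sub_smul, ← he, hx', add_sub_cancel_right])
      have hyx' : y * x' = x' := by
        rw [hx', hy, mul_add, mul_smul_comm _ _ z, hzc, smul_zero, add_zero, smul_mul_assoc, hm,
          smul_add, inv_smul_smul₀ ha, smul_smul]
      have hx'0 : x' ≠ 0 := fun h0 => hx'z 0 (by rw [h0, zero_smul])
      have hwx' : ∃ (w : M) (e f : F), w * x' = e • x' + f • z ∧ f ≠ 0 := by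
        by_contra! hcon
        refine hx'0 (hyx' ▸ hI x' hx'0 (fun m => ?_) y)
        obtain ⟨e, f, hef⟩ := hmx m
        refine ⟨e, ?_⟩
        have h1 : m * x' = e • x' + (f - e * (a⁻¹ * d)) • z := by
          rw [hx', mul_add, mul_smul_comm _ _ z, hzc, hef]
          module
        rw [h1, hcon m _ _ h1, zero_smul, add_zero]
      obtain ⟨w, e, f, hw, hf⟩ := hwx'
      have hw' : (w - e • y) * x' = f • z := by
        rw [sub_mul, smul_mul_assoc, hyx', hw, add_sub_cancel_left]
      have htop := h.span_triple_eq_top (smul_ne_zero hf hz)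
        (fun m => by rw [mul_smul_comm, hzc, smul_zero]) hw'
      have hymem : y ∈ Submodule.span F {x', w - e • y, f • z} := htop ▸ Submodule.mem_top
      obtain ⟨r, s, t, hy'⟩ := Submodule.mem_span_triple.1 hymem
      have h2 := hyx'
      rw [← hy', add_mul, add_mul, smul_mul_assoc, h.alt, smul_mul_assoc s, hw', smul_mul_assoc t,
        smul_mul_assoc f, h.mul_anticomm z, hzc] at h2
      exact hx'z (s * f) (by rw [← h2]; module)
    -- A central `x` would act as a scalar, hence be a multiple of `z` by faithfulness.
    by_cases hxc : ∀ m, m * x = 0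
    · obtain ⟨a, -, ha⟩ := h.exists_scalar_of_central hab
        (fun h0 => hxz 0 (by rw [h0, zero_smul])) hxc
      exact (hxz a (h.inj (by rw [ha, map_smul, hρz]))).elim
    · push Not at hxc
      obtain ⟨m, hm⟩ := hxc
      obtain ⟨a, d, had⟩ := hmx m
      rw [hmx0 m a d had, zero_smul, zero_add] at had
      have hd : d ≠ 0 := by rintro rfl; exact hm (by rw [had, zero_smul])
      exact ⟨x, d⁻¹ • m, z, hz, by rw [smul_mul_assoc, had, inv_smul_smul₀ hd], hzc, hρz⟩

/-- The two-dimensional nonabelian case. -/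
theorem exists_basis_of_affine [FiniteDimensional F V] (h : IsCriticalRep ρ)
    (hab : ¬ ∀ x y : M, x * y = 0) {x y : M} (hx : x ≠ 0) (hyx : y * x = x)
    (htop : Submodule.span F {x, y} = ⊤) :
    ∃ (p : ℕ) (e : Module.Basis (ZMod p) F V) (x' : M) (α : F), p.Prime ∧ CharP F p ∧
      y * x' = x' ∧ Submodule.span F {x', y} = ⊤ ∧ LinearIndependent F ![x', y] ∧
      (∀ i, ρ x' (e i) = e (i + 1)) ∧ (∀ i, ρ y (e i) = (α + (i.cast : F)) • e i) ∧
      ∀ a : F, ∃ t : F, a = t ^ p - t := by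
  have hI : ∀ m : M, ∃ c : F, m * x = c • x := fun m => by
    have hm : m ∈ Submodule.span F {x, y} := htop ▸ Submodule.mem_top
    obtain ⟨a, b, rfl⟩ := Submodule.mem_span_pair.1 hm
    exact ⟨b, by rw [add_mul, smul_mul_assoc, smul_mul_assoc, h.alt, hyx, smul_zero, zero_add]⟩
  have hinj : Function.Injective (ρ x) := (injective_iff_map_eq_zero _).2 fun a ha =>
    h.eq_zero_of_apply_eq_zero hx hI ha
  obtain ⟨a, b, ha, hab'⟩ := h.exists_eigenvector (h.span_singleton_ne_top hab x)
  obtain ⟨v, α, hv, hvα⟩ := h.exists_eigenvector (h.span_singleton_ne_top hab y)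
  have hb : b ≠ 0 := by
    rintro rfl
    exact ha (h.eq_zero_of_apply_eq_zero hx hI (by rw [hab', zero_smul]))
  have hcomm : ρ y * ρ x - ρ x * ρ y = ρ x := by rw [← h.map_mul, hyx]
  obtain ⟨p, hp, hchar⟩ := exists_prime_charP_of_commutator_eq hcomm hinj hv hvα
  have : Fact p.Prime := ⟨hp⟩
  have hpow : ∀ n : ℕ, ((ρ x) ^ n) a = b ^ n • a := fun n => by
    induction n with
    | zero => simp
    | succ n ih => rw [pow_succ', Module.End.mul_apply, ih, map_smul, hab', smul_smul, pow_succ]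
  -- `YX^p = X^pY + pX^p`, so `X^p` commutes with the action; dividing `x` by `b` then gives `X^p =
  -- 1`.
  have hxp : (ρ x) ^ p = b ^ p • 1 := h.eq_smul_one_of_commute (commute_of_span_eq_top htop (by
    rintro m (rfl | rfl)
    · rw [← pow_succ, ← pow_succ']
    · rw [mul_pow_eq_of_commutator_eq hcomm, CharP.cast_eq_zero, zero_smul, add_zero])) ha (hpow p)
  obtain ⟨x', hx'⟩ : ∃ x', x' = b⁻¹ • x := ⟨_, rfl⟩
  have hx'0 : x' ≠ 0 := hx' ▸ smul_ne_zero (inv_ne_zero hb) hx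
  have hyx' : y * x' = x' := by rw [hx', mul_smul_comm, hyx]
  have hI' : ∀ m : M, ∃ c : F, m * x' = c • x' := fun m => by
    obtain ⟨c, hc⟩ := hI m
    exact ⟨c, by rw [hx', mul_smul_comm, hc, smul_comm]⟩
  have htop' := h.span_pair_eq_top hx'0 hI' hyx'
  have hcomm' : ρ y * ρ x' - ρ x' * ρ y = ρ x' := by rw [← h.map_mul, hyx']
  have hxp' : (ρ x') ^ p = 1 := by
    rw [hx', map_smul, smul_pow, hxp, smul_smul, ← mul_pow, inv_mul_cancel₀ hb, one_pow, one_smul]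
  have hXe := apply_orbitFamily hxp' v
  have hYe := fun i => (hasEigenvector_orbitFamily hcomm' hxp' hv hvα i).apply_eq_smul
  have hspan := h.span_range_eq_top htop' (e := orbitFamily p (ρ x') v) (i := 0)
    (by rwa [orbitFamily_zero]) (by
      rintro m (rfl | rfl) j
      · rw [hXe]
        exact Submodule.subset_span ⟨_, rfl⟩
      · rw [hYe]
        exact Submodule.smul_mem _ _ (Submodule.subset_span ⟨_, rfl⟩))
  obtain ⟨e, he⟩ : ∃ e : Module.Basis (ZMod p) F V, ∀ i, e i = orbitFamily p (ρ x') v i :=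
    ⟨Module.Basis.mk (linearIndependent_orbitFamily hcomm' hxp' hv hvα) hspan.ge,
      fun i => Module.Basis.mk_apply _ _ i⟩
  have hX : ∀ i, ρ x' (e i) = e (i + 1) := fun i => by rw [he, he, hXe]
  have hY : ∀ i, ρ y (e i) = (α + (i.cast : F)) • e i := fun i => by rw [he, hYe]
  refine ⟨p, e, x', α, hp, hchar, hyx', htop', ?_, hX, hY, fun c => ?_⟩
  · rw [LinearIndependent.pair_iff]
    intro s t hst
    have h1 := congrArg (· * x') hst
    simp only [add_mul, smul_mul_assoc, h.alt, hyx', smul_zero, zero_add, zero_mul] at h1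
    have ht : t = 0 := (smul_eq_zero.1 h1).resolve_right hx'0
    rw [ht, zero_smul, add_zero] at hst
    exact ⟨(smul_eq_zero.1 hst).resolve_right hx'0, ht⟩
  · rcases eq_or_ne c 0 with rfl | hc
    · exact ⟨0, by simp [hp.ne_zero]⟩
    -- The eigenvector equation for `y + cx'` is a cyclic recursion on coordinates. As `c ≠ 0`, one
    -- zero coordinate would propagate backwards to all; so the coordinates cancel from the product
    -- of the recursions over `ℤ/p`.
    obtain ⟨w, t, hw, hwt⟩ := h.exists_eigenvector (h.span_singleton_ne_top hab (y + c • x'))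
    have hcX : ∀ i u, e.repr (ρ x' u) (i + 1) = e.repr u i := fun i u => by
      have : (e.coord (i + 1)).comp (ρ x') = e.coord i := e.ext fun j => by
        simp [hX, Finsupp.single_apply]
      exact congrArg (fun T : V →ₗ[F] F => T u) this
    have hcY : ∀ i u, e.repr (ρ y u) i = (α + (i.cast : F)) * e.repr u i := fun i u => by
      have : (e.coord i).comp (ρ y) = (α + (i.cast : F)) • e.coord i := e.ext fun j => by
        rcases eq_or_ne j i with rfl | hji
        · simp [hY]
        · simp [hY, hji]
      exact congrArg (fun T : V →ₗ[F] F => T u) this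
    have hrec : ∀ i : ZMod p, (t - α - ((i + 1 : ZMod p).cast : F)) * e.repr w (i + 1) =
        c * e.repr w i := fun i => by
      have h1 := congrArg (fun u => e.repr u (i + 1)) hwt
      simp only [map_add, map_smul, LinearMap.add_apply, LinearMap.smul_apply, Finsupp.add_apply,
        Finsupp.smul_apply, smul_eq_mul, hcX, hcY] at h1
      linear_combination -h1
    have hne : ∀ i, e.repr w i ≠ 0 := by
      intro i hi
      have hall : ∀ n : ℕ, e.repr w (i - n) = 0 := fun n => by
        induction n with
        | zero => simpa using hi
        | succ n ih =>
          have h1 := hrec (i - (n + 1 : ℕ))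
          have h2 : i - ((n + 1 : ℕ) : ZMod p) + 1 = i - n := by push_cast; ring
          rw [h2, ih, mul_zero] at h1
          exact (mul_eq_zero.1 h1.symm).resolve_left hc
      refine hw (e.repr.map_eq_zero_iff.1 (Finsupp.ext fun j => ?_))
      have h1 := hall (i - j).val
      rwa [ZMod.natCast_zmod_val, sub_sub_cancel] at h1
    have hprod : ∏ i : ZMod p, ((t - α) - (i.cast : F)) = c ^ p := by
      have h1 : (∏ i : ZMod p, ((t - α) - (i.cast : F))) * ∏ i, e.repr w i =
          c ^ p * ∏ i, e.repr w i := by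
        rw [← Finset.prod_mul_distrib, ← Equiv.prod_comp (Equiv.addRight (1 : ZMod p))]
        simp only [Equiv.coe_addRight, hrec]
        rw [Finset.prod_mul_distrib]
        simp [ZMod.card]
      exact mul_right_cancel₀ (Finset.prod_ne_zero_iff.2 fun i _ => hne i) h1
    rw [prod_sub_zmodCast] at hprod
    -- With `s = t - α` the product says `s^p - s = c^p`; hence `(s - c)^p - (s - c) = c`.
    refine ⟨t - α - c, ?_⟩
    rw [sub_pow_char (t - α) c, ← hprod]
    ring

theorem mul_pow_succ_eq_of_commutator_eq_one {X Y : Module.End F V} (h : Y * X - X * Y = 1)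
    (n : ℕ) : Y * X ^ (n + 1) = X ^ (n + 1) * Y + ((n + 1 : ℕ) : F) • X ^ n := by
  have h' : Y * X = X * Y + 1 := by rw [← sub_eq_iff_eq_add', h]
  induction n with
  | zero => simp [h']
  | succ n ih =>
    rw [pow_succ X (n + 1), ← mul_assoc, ih, add_mul, mul_assoc, h', mul_add, ← mul_assoc,
      smul_mul_assoc, ← pow_succ, ← pow_succ, mul_one]
    push_cast
    module

/-- The Heisenberg case. -/
theorem exists_basis_of_heisenberg [FiniteDimensional F V] (h : IsCriticalRep ρ)
    (hab : ¬ ∀ x y : M, x * y = 0) {x y z : M} (hz : z ≠ 0) (hyx : y * x = z)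
    (hzc : ∀ m, m * z = 0) (hρz : ρ z = 1) :
    ∃ (p : ℕ) (e : Module.Basis (ZMod p) F V) (x' y' : M), p.Prime ∧ CharP F p ∧
      y' * x' = z ∧ Submodule.span F {x', y', z} = ⊤ ∧ LinearIndependent F ![x', y', z] ∧
      (∀ i, ρ x' (e i) = e (i + 1)) ∧ (∀ i, ρ y' (e i) = ((i.cast : F) + 1) • e (i - 1)) ∧
      (p = 2 → PerfectField F) := by
  have hzc' : ∀ m, z * m = 0 := fun m => by rw [h.mul_anticomm, hzc, neg_zero]
  obtain ⟨p, hchar⟩ := CharP.exists F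
  have hp : p.Prime := by
    refine (CharP.char_is_prime_or_zero F p).resolve_right ?_
    rintro rfl
    have := CharP.charP_to_charZero F
    have h1 := congrArg (LinearMap.trace F V) (h.map_mul y x)
    -- A commutator has trace zero, whereas the identity has trace `dim V`.
    rw [hyx, hρz, map_sub, LinearMap.trace_mul_comm, sub_self, LinearMap.trace_one] at h1
    have h2 := h.one_lt_finrank
    rw [Nat.cast_eq_zero] at h1
    omega
  have : Fact p.Prime := ⟨hp⟩
  obtain ⟨a, b, ha, hab'⟩ := h.exists_eigenvector (h.span_singleton_ne_top hab x)
  obtain ⟨v, d, hv, hvd⟩ := h.exists_eigenvector (h.span_singleton_ne_top hab y)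
  -- Since `z` acts as the identity, adding multiples of it moves the eigenvalues to `1` for `x'`
  -- and `0` for `y'`.
  obtain ⟨x', hx'⟩ : ∃ x', x' = x + (1 - b) • z := ⟨_, rfl⟩
  obtain ⟨y', hy'⟩ : ∃ y', y' = y - d • z := ⟨_, rfl⟩
  have hyx' : y' * x' = z := by
    rw [hx', hy', mul_add, mul_smul_comm, hzc, smul_zero, add_zero, sub_mul, smul_mul_assoc, hzc',
      smul_zero, sub_zero, hyx]
  have hXa : ρ x' a = a := by
    rw [hx', map_add, map_smul, hρz, LinearMap.add_apply, hab', LinearMap.smul_apply,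
      Module.End.one_apply]
    module
  have hYv : ρ y' v = 0 := by
    rw [hy', map_sub, map_smul, hρz, LinearMap.sub_apply, hvd, LinearMap.smul_apply,
      Module.End.one_apply, sub_self]
  have htop := h.span_triple_eq_top hz hzc hyx'
  have hcomm : ρ y' * ρ x' - ρ x' * ρ y' = 1 := by rw [← h.map_mul, hyx', hρz]
  have hpow : ∀ n : ℕ, ((ρ x') ^ n) a = (1 : F) • a := fun n => by
    rw [one_smul]
    induction n with
    | zero => simp
    | succ n ih => rw [pow_succ, Module.End.mul_apply, hXa, ih]
  have hxp : (ρ x') ^ p = 1 := by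
    rw [← one_smul F (1 : Module.End F V)]
    refine h.eq_smul_one_of_commute (commute_of_span_eq_top htop ?_) ha (hpow p)
    rintro m (rfl | rfl | rfl)
    · rw [← pow_succ, ← pow_succ']
    · obtain ⟨n, rfl⟩ := Nat.exists_eq_succ_of_ne_zero hp.ne_zero
      rw [Nat.succ_eq_add_one, mul_pow_succ_eq_of_commutator_eq_one hcomm, CharP.cast_eq_zero,
        zero_smul, add_zero]
    · rw [hρz, mul_one, one_mul]
  have hinj := injective_of_pow_eq_one hp.ne_zero hxp
  -- `XY` and `X` satisfy the affine relation, so the orbit lemmas apply to `XY`. Starting at `Xv`,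
  -- of eigenvalue `1`, gives `XYeᵢ = (i + 1)eᵢ`, and cancelling `X` gives the formula for `Y`.
  have hcomm' : (ρ x' * ρ y') * ρ x' - ρ x' * (ρ x' * ρ y') = ρ x' := by
    rw [mul_assoc, ← mul_sub, hcomm, mul_one]
  have hu : ρ x' v ≠ 0 := (map_ne_zero_iff _ hinj).2 hv
  have hu1 : (ρ x' * ρ y') (ρ x' v) = (1 : F) • ρ x' v := by
    have h1 := congrArg (fun T : Module.End F V => T v) hcomm
    simp only [LinearMap.sub_apply, Module.End.mul_apply, hYv, map_zero, sub_zero,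
      Module.End.one_apply] at h1
    rw [Module.End.mul_apply, h1, one_smul]
  have hXe := apply_orbitFamily hxp (ρ x' v)
  have hYe : ∀ i : ZMod p, ρ y' (orbitFamily p (ρ x') (ρ x' v) i) =
      ((i.cast : F) + 1) • orbitFamily p (ρ x') (ρ x' v) (i - 1) := fun i => by
    have h1 := (hasEigenvector_orbitFamily hcomm' hxp hu hu1 i).apply_eq_smul
    refine hinj ?_
    rw [map_smul, hXe, sub_add_cancel, add_comm, ← h1, Module.End.mul_apply]
  have hspan := h.span_range_eq_top htop (e := orbitFamily p (ρ x') (ρ x' v)) (i := 0)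
    (by rwa [orbitFamily_zero]) (by
      rintro m (rfl | rfl | rfl) j
      · rw [hXe]
        exact Submodule.subset_span ⟨_, rfl⟩
      · rw [hYe]
        exact Submodule.smul_mem _ _ (Submodule.subset_span ⟨_, rfl⟩)
      · rw [hρz]
        exact Submodule.subset_span ⟨_, rfl⟩)
  obtain ⟨e, he⟩ : ∃ e : Module.Basis (ZMod p) F V,
      ∀ i, e i = orbitFamily p (ρ x') (ρ x' v) i :=
    ⟨Module.Basis.mk (linearIndependent_orbitFamily hcomm' hxp hu hu1) hspan.ge,
      fun i => Module.Basis.mk_apply _ _ i⟩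
  refine ⟨p, e, x', y', hp, hchar, hyx', htop, ?_, fun i => by rw [he, he, hXe],
    fun i => by rw [he, he, hYe], ?_⟩
  · rw [Fintype.linearIndependent_iff]
    intro g hg
    simp only [Fin.sum_univ_three, Matrix.cons_val] at hg
    have hxy' : x' * y' = -z := by rw [h.mul_anticomm, hyx']
    have h1 := congrArg (· * x') hg
    have h0 := congrArg (· * y') hg
    simp only [add_mul, smul_mul_assoc, h.alt, hyx', hxy', hzc', smul_zero, zero_add, add_zero,
      zero_mul, smul_neg, neg_eq_zero] at h0 h1
    have hg0 : g 0 = 0 := (smul_eq_zero.1 h0).resolve_right hz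
    have hg1 : g 1 = 0 := (smul_eq_zero.1 h1).resolve_right hz
    rw [hg0, hg1, zero_smul, zero_smul, zero_add, zero_add] at hg
    have hg2 : g 2 = 0 := (smul_eq_zero.1 hg).resolve_right hz
    intro i
    fin_cases i <;> assumption
  · rintro rfl
    have h2 : (2 : F) = 0 := CharP.cast_eq_zero F 2
    have hYX : ρ y' * ρ x' = ρ x' * ρ y' + 1 := by rw [← sub_eq_iff_eq_add', hcomm]
    -- In characteristic two `Y²` commutes with `X`, and it kills `v`.
    have hY2 : ρ y' * ρ y' = 0 := by
      rw [← zero_smul F (1 : Module.End F V)]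
      refine h.eq_smul_one_of_commute (commute_of_span_eq_top htop ?_) hv
        (by rw [Module.End.mul_apply, hYv, map_zero, zero_smul])
      rintro m (rfl | rfl | rfl)
      · have h3 : ρ y' + ρ y' = 0 := by rw [← two_smul F, h2, zero_smul]
        rw [mul_assoc, hYX, mul_add, ← mul_assoc, hYX, mul_one, add_mul, one_mul, add_assoc, h3,
          add_zero, mul_assoc]
      · rw [mul_assoc]
      · rw [hρz, mul_one, one_mul]
    have hsq : ∀ r : F, ∃ t : F, t ^ 2 = r := fun r => by
      obtain ⟨w, t, hw, hwt⟩ :=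
        h.exists_eigenvector (h.span_singleton_ne_top hab (x' + (r - 1) • y'))
      refine ⟨t, ?_⟩
      -- `X² = 1`, `Y² = 0` and `XY + YX = 1`, so the coefficient `r - 1` makes the square equal to
      -- `r`; the eigenvalue `t` is a square root of `r`.
      have h3 : ρ (x' + (r - 1) • y') * ρ (x' + (r - 1) • y') = r • 1 := by
        have h4 : ρ x' * ρ x' = 1 := by rw [← pow_two, hxp]
        rw [map_add, map_smul, mul_add, add_mul, add_mul, h4, mul_smul_comm, smul_mul_assoc,
          mul_smul_comm, smul_mul_assoc, hY2, hYX]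
        have h5 : (r - 1) • (ρ x' * ρ y') + (r - 1) • (ρ x' * ρ y') = 0 := by
          rw [← two_smul F, h2, zero_smul]
        calc _ = ((r - 1) • (ρ x' * ρ y') + (r - 1) • (ρ x' * ρ y')) + r • 1 := by module
          _ = _ := by rw [h5, zero_add]
      have h6 := congrArg (fun T : Module.End F V => T w) h3
      simp only [Module.End.mul_apply, hwt, map_smul, smul_smul, LinearMap.smul_apply,
        Module.End.one_apply] at h6
      rw [pow_two]
      exact smul_left_injective F hw h6
    have : ExpChar F 2 := ExpChar.prime hp
    have := PerfectRing.ofSurjective F 2 fun r => hsq r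
    exact PerfectRing.toPerfectField F 2

end IsCriticalRep
end LeibnizAlg

/-! ### Ideals, `Leib(L)` and complements. -/

namespace LeibnizAlg

section Ideals

variable {F L : Type*} [Field F] [NonUnitalNonAssocRing L] [Module F L]

theorem mul_mem_prodSpan {I J : Submodule F L} {a b : L} (ha : a ∈ I) (hb : b ∈ J) :
    a * b ∈ prodSpan F I J :=
  Submodule.subset_span ⟨a, ha, b, hb, rfl⟩

theorem prodSpan_le {I J K : Submodule F L} :
    prodSpan F I J ≤ K ↔ ∀ a ∈ I, ∀ b ∈ J, a * b ∈ K := by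
  refine ⟨fun h a ha b hb => h (mul_mem_prodSpan ha hb), fun h => Submodule.span_le.2 ?_⟩
  rintro _ ⟨a, ha, b, hb, rfl⟩
  exact h a ha b hb

theorem isIdeal_bot : IsIdeal F (⊥ : Submodule F L) := by
  intro v a ha
  rw [Submodule.mem_bot] at ha
  simp [ha]

theorem IsIdeal.inf {I J : Submodule F L} (hI : IsIdeal F I) (hJ : IsIdeal F J) :
    IsIdeal F (I ⊓ J) := fun v a ha =>
  ⟨⟨(hI v a ha.1).1, (hJ v a ha.2).1⟩, ⟨(hI v a ha.1).2, (hJ v a ha.2).2⟩⟩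

theorem IsMinimalIdeal.le_of_inf_ne_bot {A I : Submodule F L} (hA : IsMinimalIdeal F A)
    (hI : IsIdeal F I) (h : A ⊓ I ≠ ⊥) : A ≤ I := by
  rcases hA.2.2 _ (hA.1.inf hI) inf_le_left with h1 | h1
  · exact (h h1).elim
  · exact inf_eq_left.1 h1

theorem exists_isMinimalIdeal_le [FiniteDimensional F L] {I : Submodule F L} (hI : IsIdeal F I)
    (hI0 : I ≠ ⊥) : ∃ A : Submodule F L, IsMinimalIdeal F A ∧ A ≤ I := by
  obtain ⟨A, ⟨hA, hA0, hAI⟩, hmin⟩ := WellFounded.has_min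
    (wellFounded_lt (α := Submodule F L)) {B | IsIdeal F B ∧ B ≠ ⊥ ∧ B ≤ I} ⟨I, hI, hI0, le_rfl⟩
  refine ⟨A, ⟨hA, hA0, fun B hB hBA => ?_⟩, hAI⟩
  by_contra! hcon
  exact hmin B ⟨hB, hcon.1, hBA.trans hAI⟩ (lt_of_le_of_ne hBA hcon.2)

variable [IsScalarTower F L L] [SMulCommClass F L L]

theorem isIdeal_span {s : Set L}
    (h : ∀ v : L, ∀ a ∈ s, v * a ∈ Submodule.span F s ∧ a * v ∈ Submodule.span F s) :
    IsIdeal F (Submodule.span F s) := by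
  intro v a ha
  induction ha using Submodule.span_induction with
  | mem x hx => exact h v x hx
  | zero => simp
  | add x y _ _ hx hy =>
    rw [mul_add, add_mul]
    exact ⟨Submodule.add_mem _ hx.1 hy.1, Submodule.add_mem _ hx.2 hy.2⟩
  | smul c x _ hx =>
    rw [mul_smul_comm, smul_mul_assoc]
    exact ⟨Submodule.smul_mem _ c hx.1, Submodule.smul_mem _ c hx.2⟩

theorem mul_self_mul (hL : IsLeibniz L) (a b : L) : a * a * b = 0 := by
  have := hL a a b
  rwa [right_eq_add] at this

omit [SMulCommClass F L L] in
theorem leib_mul (hL : IsLeibniz L) {a : L} (ha : a ∈ leib F L) (b : L) : a * b = 0 := by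
  induction ha using Submodule.span_induction with
  | mem x hx =>
    obtain ⟨a, rfl⟩ := hx
    exact mul_self_mul hL a b
  | zero => simp
  | add x y _ _ hx hy => rw [add_mul, hx, hy, add_zero]
  | smul c x _ hx => rw [smul_mul_assoc, hx, smul_zero]

omit [IsScalarTower F L L] [SMulCommClass F L L] in
theorem mul_self_mem_leib (a : L) : a * a ∈ leib F L := Submodule.subset_span ⟨a, rfl⟩

theorem isIdeal_leib (hL : IsLeibniz L) : IsIdeal F (leib F L) := by
  refine isIdeal_span fun v a ha => ?_
  obtain ⟨a, rfl⟩ := ha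
  rw [mul_self_mul hL]
  refine ⟨?_, Submodule.zero_mem _⟩
  -- Polarisation of `(va)a + a(va)`.
  have h1 : v * (a * a) = (v * a + a) * (v * a + a) - (v * a) * (v * a) - a * a := by
    rw [hL v a a, add_mul, mul_add, mul_add]
    abel
  rw [h1]
  exact Submodule.sub_mem _ (Submodule.sub_mem _ (mul_self_mem_leib _) (mul_self_mem_leib _))
    (mul_self_mem_leib _)

theorem IsIdeal.prodSpan_self (hL : IsLeibniz L) {I : Submodule F L} (hI : IsIdeal F I) :
    IsIdeal F (prodSpan F I I) := by
  refine isIdeal_span fun v c hc => ?_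
  obtain ⟨a, ha, b, hb, rfl⟩ := hc
  have h1 : a * b * v = a * (b * v) - b * (a * v) := by rw [hL a b v, add_sub_cancel_right]
  rw [hL v a b, h1]
  exact ⟨Submodule.add_mem _ (mul_mem_prodSpan (hI v a ha).1 hb)
      (mul_mem_prodSpan ha (hI v b hb).1),
    Submodule.sub_mem _ (mul_mem_prodSpan ha (hI v b hb).2) (mul_mem_prodSpan hb (hI v a ha).2)⟩

/-- A minimal ideal of a solvable Leibniz algebra is abelian. -/
theorem IsMinimalIdeal.mul_eq_zero (hL : IsLeibniz L) (hs : Solvable F L) {A : Submodule F L}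
    (hA : IsMinimalIdeal F A) : ∀ a ∈ A, ∀ b ∈ A, a * b = 0 := by
  have hle : prodSpan F A A ≤ A := prodSpan_le.2 fun a _ b hb => (hA.1 a b hb).1
  rcases hA.2.2 _ (hA.1.prodSpan_self hL) hle with h | h
  · intro a ha b hb
    simpa [h] using mul_mem_prodSpan (F := F) ha hb
  · have hder : ∀ n, A ≤ derived F L n := fun n => by
      induction n with
      | zero => exact le_top
      | succ n ih =>
        rw [← h]
        exact prodSpan_le.2 fun a ha b hb => mul_mem_prodSpan (ih ha) (ih hb)
    obtain ⟨n, hn⟩ := hs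
    exact (hA.2.1 (le_bot_iff.1 (hn ▸ hder n))).elim

omit [IsScalarTower F L L] [SMulCommClass F L L] in
/-- The sum of an ideal and a subalgebra is a subalgebra. -/
theorem IsIdeal.sup_mul_mem {A S : Submodule F L} (hA : IsIdeal F A)
    (hS : ∀ x ∈ S, ∀ y ∈ S, x * y ∈ S) : ∀ x ∈ A ⊔ S, ∀ y ∈ A ⊔ S, x * y ∈ A ⊔ S := by
  intro x hx y hy
  obtain ⟨a, ha, s, hs, rfl⟩ := Submodule.mem_sup.1 hx
  obtain ⟨b, hb, t, ht, rfl⟩ := Submodule.mem_sup.1 hy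
  rw [add_mul, mul_add s]
  exact Submodule.add_mem _ (Submodule.mem_sup_left (hA _ a ha).2)
    (Submodule.add_mem _ (Submodule.mem_sup_left (hA _ b hb).1)
      (Submodule.mem_sup_right (hS s hs t ht)))

/-- A subspace closed under products, as a subalgebra. -/
def subalgebraOfMulMem (S : Submodule F L) (hS : ∀ x ∈ S, ∀ y ∈ S, x * y ∈ S) :
    NonUnitalSubalgebra F L :=
  { S with mul_mem' := fun {a b} ha hb => hS a ha b hb }

omit [IsScalarTower F L L] [SMulCommClass F L L] in
theorem mem_subalgebraOfMulMem {S : Submodule F L} {hS : ∀ x ∈ S, ∀ y ∈ S, x * y ∈ S} {x : L} :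
    x ∈ subalgebraOfMulMem S hS ↔ x ∈ S := Iff.rfl

/-- An abelian minimal ideal of a `φ`-free algebra has a complementary subalgebra. -/
theorem exists_isCompl_subalgebra (hphi : PhiFree F L) {A : Submodule F L}
    (hA : IsMinimalIdeal F A) (hab : ∀ a ∈ A, ∀ b ∈ A, a * b = 0) :
    ∃ M : NonUnitalSubalgebra F L, IsCompl A M.toSubmodule := by
  have hnle : ¬ A ≤ (frattini F L).toSubmodule := fun hle => by
    have : A ≤ frattiniIdeal F L := le_sSup ⟨hA.1, hle⟩
    rw [hphi] at this
    exact hA.2.1 (le_bot_iff.1 this)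
  obtain ⟨a, ha, haF⟩ := Set.not_subset.1 hnle
  have haF' : a ∉ frattini F L := haF
  rw [frattini, NonUnitalAlgebra.mem_sInf] at haF'
  push Not at haF'
  obtain ⟨M, hM, haM⟩ := haF'
  -- The complement is a maximal subalgebra `M` missing a point of `A`: maximality gives `A + M =
  -- L`, and `A ∩ M` is an ideal because `A` is abelian.
  have hmul := hA.1.sup_mul_mem (S := M.toSubmodule) fun x hx y hy => M.mul_mem hx hy
  have htop : subalgebraOfMulMem _ hmul = ⊤ := hM.2 _ (lt_of_le_of_ne
    (fun x hx => Submodule.mem_sup_right hx) fun h =>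
      haM (h ▸ (Submodule.mem_sup_left ha : a ∈ A ⊔ M.toSubmodule)))
  have hsup : A ⊔ M.toSubmodule = ⊤ := eq_top_iff.2 fun x _ =>
    mem_subalgebraOfMulMem.1 (htop ▸ NonUnitalAlgebra.mem_top : x ∈ subalgebraOfMulMem _ hmul)
  refine ⟨M, ⟨disjoint_iff.2 ?_, codisjoint_iff.2 hsup⟩⟩
  have hI : IsIdeal F (A ⊓ M.toSubmodule) := by
    intro v w hw
    have hv : v ∈ A ⊔ M.toSubmodule := hsup ▸ Submodule.mem_top
    obtain ⟨b, hb, m, hm, rfl⟩ := Submodule.mem_sup.1 hv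
    refine ⟨⟨(hA.1 _ w hw.1).1, ?_⟩, ⟨(hA.1 _ w hw.1).2, ?_⟩⟩
    · rw [add_mul, hab b hb w hw.1, zero_add]
      exact M.mul_mem hm hw.2
    · rw [mul_add, hab w hw.1 b hb, zero_add]
      exact M.mul_mem hw.2 hm
  refine (hA.2.2 _ hI inf_le_left).resolve_right fun h => haM ?_
  exact (h.ge ha).2

end Ideals

/-! ### Flags and supersolvability. -/

section Flags

variable {F L : Type*} [Field F] [AddCommGroup L] [Module F L] [FiniteDimensional F L]

/-- At the first index where the chain meets `A`, the intersection is independent of the previous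
term, and the dimension has grown by at most one. -/
theorem exists_finrank_inf_eq_one {A : Submodule F L} {n : ℕ} {d : ℕ → Submodule F L}
    (h0 : A ⊓ d 0 = ⊥) (hn : A ⊓ d n ≠ ⊥) (hle : ∀ i < n, d i ≤ d (i + 1))
    (hd : ∀ i < n, Module.finrank F (d (i + 1)) ≤ Module.finrank F (d i) + 1) :
    ∃ i ≤ n, Module.finrank F (A ⊓ d i : Submodule F L) = 1 := by
  classical
  have hex : ∃ i, A ⊓ d i ≠ ⊥ := ⟨n, hn⟩
  obtain ⟨k, hk⟩ : ∃ k, Nat.find hex = k + 1 := Nat.exists_eq_succ_of_ne_zero fun h =>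
    Nat.find_spec hex (h ▸ h0)
  have hkn : k + 1 ≤ n := hk ▸ Nat.find_min' hex hn
  have hk0 : A ⊓ d k = ⊥ := not_not.1 (Nat.find_min hex (by omega : k < Nat.find hex))
  have hk1 : A ⊓ d (k + 1) ≠ ⊥ := hk ▸ Nat.find_spec hex
  refine ⟨k + 1, hkn, le_antisymm ?_ (Submodule.one_le_finrank_iff.2 hk1)⟩
  have h1 := Submodule.finrank_sup_add_finrank_inf_eq (A ⊓ d (k + 1)) (d k)
  have h2 : A ⊓ d (k + 1) ⊓ d k = ⊥ := by
    rw [inf_assoc, inf_eq_right.2 (hle k hkn), hk0]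
  have h3 := Submodule.finrank_mono (sup_le (inf_le_right (a := A)) (hle k hkn))
  have h4 := hd k hkn
  rw [h2, finrank_bot] at h1
  omega

end Flags

section Supersolvable

variable {F L : Type*} [Field F] [NonUnitalNonAssocRing L] [Module F L]
  [FiniteDimensional F L]

/-- A nonzero ideal `A` of a supersolvable subalgebra `T` contains a one-dimensional ideal. -/
theorem exists_finrank_eq_one_of_supersolvable {A : Submodule F L} {T : NonUnitalSubalgebra F L}
    (hT : Supersolvable F T) (hAT : A ≤ T.toSubmodule) (hA0 : A ≠ ⊥)
    (hA : ∀ t ∈ T, ∀ a ∈ A, t * a ∈ A) :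
    ∃ B ≤ A, Module.finrank F B = 1 ∧ ∀ t ∈ T, ∀ b ∈ B, t * b ∈ B := by
  obtain ⟨n, c, h0, hn, hc, hle⟩ := hT
  have hfr : ∀ i, Module.finrank F ((c i).map T.toSubmodule.subtype) = Module.finrank F (c i) :=
    fun i => Submodule.finrank_map_subtype_eq T.toSubmodule (c i)
  obtain ⟨i, hi, h1⟩ := exists_finrank_inf_eq_one (A := A) (n := n)
    (d := fun i => (c i).map T.toSubmodule.subtype) (by simp [h0])
    (by
      rw [hn, Submodule.map_top, Submodule.range_subtype, inf_eq_left.2 hAT]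
      exact hA0)
    (fun i hi => Submodule.map_mono (hle i hi))
    (fun i hi => by
      rw [hfr, hfr, (hc i hi.le).2, (hc _ hi).2])
  refine ⟨A ⊓ (c i).map T.toSubmodule.subtype, inf_le_left, h1,
    fun t ht b hb => ⟨hA t ht b hb.1, ?_⟩⟩
  obtain ⟨b', hb', rfl⟩ := hb.2
  have h2 := ((hc i hi).1 ⟨t, ht⟩ b' hb').1
  exact ⟨_, h2, rfl⟩

/-- If `L = B ∔ M` with an ideal `B` and a supersolvable subalgebra `M`, then a flag of ideals of
`M` yields a flag of ideals of `L` that starts at `B`. -/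
theorem exists_flag_of_isCompl {B : Submodule F L} {M : NonUnitalSubalgebra F L}
    (hB : IsIdeal F B) (hc : IsCompl B M.toSubmodule) (hM : Supersolvable F M) :
    ∃ (n : ℕ) (d : ℕ → Submodule F L), d 0 = B ∧ d n = ⊤ ∧
      (∀ i ≤ n, IsIdeal F (d i) ∧ Module.finrank F (d i) = Module.finrank F B + i) ∧
      ∀ i < n, d i ≤ d (i + 1) := by
  obtain ⟨n, c, h0, hn, hcI, hle⟩ := hM
  refine ⟨n, fun i => B ⊔ (c i).map M.toSubmodule.subtype, by simp [h0], ?_, fun i hi => ⟨?_, ?_⟩,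
    fun i hi => sup_le_sup_left (Submodule.map_mono (hle i hi)) _⟩
  · simp only [hn, Submodule.map_top, Submodule.range_subtype, hc.sup_eq_top]
  · intro v w hw
    have hv : v ∈ B ⊔ M.toSubmodule := hc.sup_eq_top ▸ Submodule.mem_top
    obtain ⟨b, hb, m, hm, rfl⟩ := Submodule.mem_sup.1 hv
    obtain ⟨b', hb', u, hu, rfl⟩ := Submodule.mem_sup.1 hw
    obtain ⟨u, hu, rfl⟩ := hu
    have h1 := (hcI i hi).1 ⟨m, hm⟩ u hu
    constructor
    · rw [mul_add, add_mul b m (M.toSubmodule.subtype u)]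
      exact Submodule.add_mem _ (Submodule.mem_sup_left (hB _ _ hb').1) (Submodule.add_mem _
        (Submodule.mem_sup_left (hB _ _ hb).2) (Submodule.mem_sup_right ⟨_, h1.1, rfl⟩))
    · rw [add_mul, mul_add (M.toSubmodule.subtype u)]
      exact Submodule.add_mem _ (Submodule.mem_sup_left (hB _ _ hb').2) (Submodule.add_mem _
        (Submodule.mem_sup_left (hB _ _ hb).1) (Submodule.mem_sup_right ⟨_, h1.2, rfl⟩))
  · have h1 := Submodule.finrank_sup_add_finrank_inf_eq B ((c i).map M.toSubmodule.subtype)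
    have h2 : B ⊓ (c i).map M.toSubmodule.subtype = ⊥ := by
      refine le_bot_iff.1 (le_trans (inf_le_inf_left _ ?_) hc.inf_eq_bot.le)
      exact Submodule.map_subtype_le _ _
    have h3 : Module.finrank F ((c i).map M.toSubmodule.subtype) = i :=
      (Submodule.finrank_map_subtype_eq M.toSubmodule (c i)).trans (hcI i hi).2
    rwa [h2, finrank_bot, h3] at h1

theorem supersolvable_of_finrank_eq_one {A : Submodule F L} {M : NonUnitalSubalgebra F L}
    (hA : IsIdeal F A) (hc : IsCompl A M.toSubmodule) (hM : Supersolvable F M)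
    (h1 : Module.finrank F A = 1) : Supersolvable F L := by
  obtain ⟨n, d, h0, hn, hd, hle⟩ := exists_flag_of_isCompl hA hc hM
  refine ⟨n + 1, fun i => Nat.casesOn i ⊥ d, rfl, hn, fun i hi => ?_, fun i hi => ?_⟩
  · cases i with
    | zero => exact ⟨isIdeal_bot, finrank_bot F L⟩
    | succ i => exact ⟨(hd i (by omega)).1, by rw [(hd i (by omega)).2, h1, add_comm]⟩
  · cases i with
    | zero => exact bot_le
    | succ i => exact hle i (by omega)

end Supersolvable

end LeibnizAlg

/-! ### The action of the complement on the minimal ideal. -/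

namespace LeibnizAlg

section

variable {F L : Type*} [Field F] [NonUnitalNonAssocRing L] [Module F L]
  [IsScalarTower F L L] [SMulCommClass F L L]

/-- The action of a subalgebra on an ideal by left multiplication. -/
def leftRep {A : Submodule F L} (hA : IsIdeal F A) (M : NonUnitalSubalgebra F L) :
    M →ₗ[F] Module.End F A :=
  LinearMap.mk₂ F (fun m a => ⟨(m : L) * a, (hA m a a.2).1⟩)
    (fun _ _ _ => Subtype.ext (add_mul _ _ _)) (fun _ _ _ => Subtype.ext (smul_mul_assoc _ _ _))
    (fun _ _ _ => Subtype.ext (mul_add _ _ _)) (fun _ _ _ => Subtype.ext (mul_smul_comm _ _ _))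

@[simp]
theorem coe_leftRep_apply {A : Submodule F L} (hA : IsIdeal F A) (M : NonUnitalSubalgebra F L)
    (m : M) (a : A) : (leftRep hA M m a : L) = m * a := rfl

omit [IsScalarTower F L L] [SMulCommClass F L L] in
/-- A subspace of `A` that is stable under left multiplication by a complement of the abelian ideal
`A` is an ideal, if the right action on `A` is zero or opposite to the left action. -/
theorem isIdeal_of_le_of_isCompl {A W : Submodule F L} {M : NonUnitalSubalgebra F L}
    (hab : ∀ a ∈ A, ∀ b ∈ A, a * b = 0) (hc : IsCompl A M.toSubmodule)
    (hR : ∀ a ∈ A, ∀ v : L, a * v = 0 ∨ a * v = -(v * a)) (hWA : W ≤ A)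
    (hW : ∀ m ∈ M, ∀ w ∈ W, m * w ∈ W) : IsIdeal F W := by
  intro v w hw
  have hl : v * w ∈ W := by
    have hv : v ∈ A ⊔ M.toSubmodule := hc.sup_eq_top ▸ Submodule.mem_top
    obtain ⟨a, ha, m, hm, rfl⟩ := Submodule.mem_sup.1 hv
    rw [add_mul, hab a ha w (hWA hw), zero_add]
    exact hW m hm w hw
  refine ⟨hl, ?_⟩
  rcases hR w (hWA hw) v with h | h
  · exact h ▸ Submodule.zero_mem _
  · exact h ▸ Submodule.neg_mem _ hl

variable [FiniteDimensional F L]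

theorem IsMinimalIdeal.finrank_ne_one {A : Submodule F L} (hA : IsMinimalIdeal F A)
    (hL : IsLeibniz L) (hs : Solvable F L) (hphi : PhiFree F L)
    (hmin : MinimallyNonSupersolvable F L) : Module.finrank F A ≠ 1 := by
  intro h1
  obtain ⟨M, hM⟩ := exists_isCompl_subalgebra hphi hA (hA.mul_eq_zero hL hs)
  refine hmin.1 (supersolvable_of_finrank_eq_one hA.1 hM (hmin.2 M ?_) h1)
  rintro rfl
  exact hA.2.1 (by simpa using hM.inf_eq_bot)

theorem IsMinimalIdeal.unique {A B : Submodule F L} (hA : IsMinimalIdeal F A)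
    (hB : IsMinimalIdeal F B) (hL : IsLeibniz L) (hs : Solvable F L) (hphi : PhiFree F L)
    (hmin : MinimallyNonSupersolvable F L) : B = A := by
  by_contra hne
  have hAB : A ⊓ B = ⊥ := by
    by_contra h
    exact hne (le_antisymm (hB.le_of_inf_ne_bot hA.1 (by rwa [inf_comm]))
      (hA.le_of_inf_ne_bot hB.1 h))
  obtain ⟨N, hN⟩ := exists_isCompl_subalgebra hphi hB (hB.mul_eq_zero hL hs)
  have hNtop : N ≠ ⊤ := by
    rintro rfl
    exact hB.2.1 (by simpa using hN.inf_eq_bot)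
  obtain ⟨n, d, h0, hn, hd, hle⟩ := exists_flag_of_isCompl hB.1 hN (hmin.2 N hNtop)
  obtain ⟨i, hi, h1⟩ := exists_finrank_inf_eq_one (A := A) (n := n) (d := d) (by rw [h0, hAB])
    (by rw [hn, inf_top_eq]; exact hA.2.1) hle
    (fun i hi => by rw [(hd _ hi).2, (hd i hi.le).2, add_assoc])
  have hne : A ⊓ d i ≠ ⊥ := fun h => by rw [h, finrank_bot] at h1; omega
  rw [inf_eq_left.2 (hA.le_of_inf_ne_bot (hd i hi).1 hne)] at h1
  exact hA.finrank_ne_one hL hs hphi hmin h1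

/-- The kernel is an ideal of `L` inside `M`; if nonzero it would contain `A`. Invariant subspaces
of `A` are ideals of `L`. For proper `S`, the subalgebra `A + S` is proper and supersolvable, so `A`
contains a line stable under `S`. -/
theorem isCriticalRep_leftRep {A : Submodule F L} (hA : IsUniqueMinimalIdeal F A)
    (hL : IsLeibniz L) (hs : Solvable F L) (hphi : PhiFree F L)
    (hmin : MinimallyNonSupersolvable F L) {M : NonUnitalSubalgebra F L}
    (hc : IsCompl A M.toSubmodule) (hM : ∀ m : M, m * m = 0)
    (hR : ∀ a ∈ A, ∀ v : L, a * v = 0 ∨ a * v = -(v * a)) :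
    IsCriticalRep (leftRep hA.1.1 M) := by
  have hab := hA.1.mul_eq_zero hL hs
  have hanti : ∀ x y : M, y * x = -(x * y) := fun x y => by
    have h1 := hM (x + y)
    rw [add_mul, mul_add, mul_add, hM, hM, zero_add, add_zero] at h1
    exact eq_neg_of_add_eq_zero_right h1
  have hmap : ∀ x y : M, leftRep hA.1.1 M (x * y) =
      leftRep hA.1.1 M x * leftRep hA.1.1 M y - leftRep hA.1.1 M y * leftRep hA.1.1 M x := by
    intro x y
    ext a
    have h1 := hL x y a
    simp [h1]
  refine ⟨hM, hmap, ?_, ?_, ?_, ?_⟩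
  · rw [← LinearMap.ker_eq_bot]
    by_contra hne
    have hI : IsIdeal F ((LinearMap.ker (leftRep hA.1.1 M)).map M.toSubmodule.subtype) := by
      have hker : ∀ m c : M, leftRep hA.1.1 M c = 0 → leftRep hA.1.1 M (m * c) = 0 :=
        fun m c hc => by rw [hmap, hc, mul_zero, zero_mul, sub_zero]
      have hker' : ∀ m c : M, leftRep hA.1.1 M c = 0 → leftRep hA.1.1 M (c * m) = 0 :=
        fun m c hc => by rw [hanti m c, map_neg, hker m c hc, neg_zero]
      rintro v _ ⟨c, hcC, rfl⟩
      have hv : v ∈ A ⊔ M.toSubmodule := hc.sup_eq_top ▸ Submodule.mem_top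
      obtain ⟨a, ha, m, hm, rfl⟩ := Submodule.mem_sup.1 hv
      have hca : (c : L) * a = 0 :=
        congrArg (fun T : Module.End F A => (T ⟨a, ha⟩ : L)) (LinearMap.mem_ker.1 hcC)
      have hac : a * (c : L) = 0 := by
        rcases hR a ha c with h | h
        · exact h
        · rw [h, hca, neg_zero]
      constructor
      · refine ⟨_, hker ⟨m, hm⟩ c hcC, ?_⟩
        rw [add_mul]
        change m * (c : L) = a * (c : L) + m * (c : L)
        rw [hac, zero_add]
      · refine ⟨_, hker' ⟨m, hm⟩ c hcC, ?_⟩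
        rw [mul_add]
        change (c : L) * m = (c : L) * a + (c : L) * m
        rw [hca, zero_add]
    obtain ⟨B, hB, hBC⟩ := exists_isMinimalIdeal_le hI fun h => hne
      (Submodule.map_injective_of_injective (Submodule.subtype_injective M.toSubmodule)
        (by rw [h, Submodule.map_bot]))
    rw [hA.2 B hB] at hBC
    exact hA.1.2.1 (hc.disjoint.eq_bot_of_le (hBC.trans (Submodule.map_subtype_le _ _)))
  · intro W hW
    have hI := isIdeal_of_le_of_isCompl hab hc hR (Submodule.map_subtype_le A W) (by
      rintro m hm _ ⟨w, hw, rfl⟩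
      exact ⟨_, hW ⟨m, hm⟩ w hw, rfl⟩)
    refine (hA.1.2.2 _ hI (Submodule.map_subtype_le A W)).imp (fun h => ?_) (fun h => ?_) <;>
      refine Submodule.map_injective_of_injective (Submodule.subtype_injective A) ?_
    · rw [h, Submodule.map_bot]
    · rw [h, Submodule.map_top, Submodule.range_subtype]
  · intro S hS hStop
    have hmul := hA.1.1.sup_mul_mem (S := S.map M.toSubmodule.subtype) (by
      rintro _ ⟨x, hx, rfl⟩ _ ⟨y, hy, rfl⟩
      exact ⟨_, hS x hx y hy, rfl⟩)
    have hT : subalgebraOfMulMem _ hmul ≠ ⊤ := fun htop => hStop (eq_top_iff.2 fun m _ => by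
      have hm : (m : L) ∈ A ⊔ S.map M.toSubmodule.subtype :=
        mem_subalgebraOfMulMem.1 (htop ▸ NonUnitalAlgebra.mem_top)
      obtain ⟨a, ha, _, ⟨s, hs, rfl⟩, has⟩ := Submodule.mem_sup.1 hm
      have h1 : (m : L) - s ∈ A := by
        rw [← has]
        simpa using ha
      have h2 : (m : L) - s = 0 := Submodule.disjoint_def.1 hc.disjoint _ h1
        (M.toSubmodule.sub_mem m.2 s.2)
      have h3 : m = s := Subtype.ext (sub_eq_zero.1 h2)
      rwa [h3])
    obtain ⟨B, hBA, hB1, hB⟩ := exists_finrank_eq_one_of_supersolvable (hmin.2 _ hT)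
      (fun a ha => (Submodule.mem_sup_left ha : a ∈ A ⊔ S.map M.toSubmodule.subtype)) hA.1.2.1
      fun t _ a ha => (hA.1.1 t a ha).1
    obtain ⟨b, hb0, hb⟩ := finrank_eq_one_iff'.1 hB1
    refine ⟨⟨b, hBA b.2⟩, fun h => hb0 (Subtype.ext (congrArg (fun a : A => (a : L)) h)), fun s hs => ?_⟩
    obtain ⟨c, hcb⟩ := hb ⟨s * b, hB s (Submodule.mem_sup_right ⟨s, hs, rfl⟩) b b.2⟩
    exact ⟨c, Subtype.ext (congrArg Subtype.val hcb).symm⟩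
  · have h0 := Submodule.one_le_finrank_iff.2 hA.1.2.1
    have h1 := hA.1.finrank_ne_one hL hs hphi hmin
    omega

omit [FiniteDimensional F L] in
/-- If `A ∔ M` is strongly solvable and `M` acts critically on `A`, then `M` is abelian. -/
theorem StronglySolvable.mul_eq_zero {A : Submodule F L} (hA : IsIdeal F A) (hA0 : A ≠ ⊥)
    {M : NonUnitalSubalgebra F L} (h : IsCriticalRep (leftRep hA M))
    (hss : StronglySolvable F L) (x y : M) : x * y = 0 := by
  by_contra hxy
  -- The span `W` of `(MM)A` is invariant, and nonzero by faithfulness, so it is `A`. Hence `A` lies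
  -- in every term of the lower central series of `L²`.
  obtain ⟨W, hWdef⟩ : ∃ W, W = Submodule.span F
    {w : A | ∃ (m₁ m₂ : M) (a : A), w = leftRep hA M (m₁ * m₂) a} := ⟨_, rfl⟩
  have hmem : ∀ (m₁ m₂ : M) (a : A), leftRep hA M (m₁ * m₂) a ∈ W := fun m₁ m₂ a =>
    hWdef ▸ Submodule.subset_span ⟨m₁, m₂, a, rfl⟩
  have hW : ∀ (m : M), ∀ w ∈ W, leftRep hA M m w ∈ W := fun m => by
    change W ≤ W.comap (leftRep hA M m)
    conv_lhs => rw [hWdef]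
    refine Submodule.span_le.2 ?_
    rintro _ ⟨m₁, m₂, a, rfl⟩
    have h1 : leftRep hA M m (leftRep hA M (m₁ * m₂) a) =
        leftRep hA M (m * (m₁ * m₂)) a + leftRep hA M (m₁ * m₂) (leftRep hA M m a) := by
      rw [h.map_mul m]
      simp
    rw [SetLike.mem_coe, Submodule.mem_comap, h1]
    exact W.add_mem (hmem _ _ _) (hmem _ _ _)
  have htop : W = ⊤ := (h.irred W hW).resolve_left fun hbot => hxy (h.inj (by
    ext a
    have h1 := hmem x y a
    rw [hbot, Submodule.mem_bot] at h1
    rw [h1, map_zero, LinearMap.zero_apply]))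
  have hle : ∀ P : Submodule F L, (∀ (m₁ m₂ : M), ∀ a ∈ A, (m₁ : L) * m₂ * a ∈ P) → A ≤ P := by
    intro P hP
    have h1 : W ≤ P.comap A.subtype := by
      rw [hWdef]
      refine Submodule.span_le.2 ?_
      rintro _ ⟨m₁, m₂, a, rfl⟩
      exact hP m₁ m₂ a a.2
    intro a ha
    exact h1 (x := ⟨a, ha⟩) (htop ▸ Submodule.mem_top)
  have hlc : ∀ n, A ≤ lowerCentral F (prodSpan F (⊤ : Submodule F L) ⊤) n := fun n => by
    induction n with
    | zero => exact hle _ fun _ _ _ _ => mul_mem_prodSpan trivial trivial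
    | succ n ih =>
      exact hle _ fun _ _ a ha => mul_mem_prodSpan (mul_mem_prodSpan trivial trivial) (ih ha)
  obtain ⟨n, hn⟩ := hss
  exact hA0 (le_bot_iff.1 (hn ▸ hlc n))

omit [IsScalarTower F L L] [SMulCommClass F L L] [FiniteDimensional F L] in
theorem stronglySolvable_of_mul_eq_zero {A M : Submodule F L} (hA : IsIdeal F A)
    (hab : ∀ a ∈ A, ∀ b ∈ A, a * b = 0) (hc : A ⊔ M = ⊤)
    (hM : ∀ x ∈ M, ∀ y ∈ M, x * y = 0) : StronglySolvable F L := by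
  have hle : prodSpan F (⊤ : Submodule F L) ⊤ ≤ A := prodSpan_le.2 fun x _ y _ => by
    have hx : x ∈ A ⊔ M := hc ▸ Submodule.mem_top
    have hy : y ∈ A ⊔ M := hc ▸ Submodule.mem_top
    obtain ⟨a, ha, m, hm, rfl⟩ := Submodule.mem_sup.1 hx
    obtain ⟨b, hb, k, hk, rfl⟩ := Submodule.mem_sup.1 hy
    rw [add_mul, mul_add m, hM m hm k hk, add_zero]
    exact A.add_mem (hA _ a ha).2 (hA m b hb).1
  refine ⟨1, le_bot_iff.1 (prodSpan_le.2 fun x hx y hy => ?_)⟩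
  rw [Submodule.mem_bot]
  exact hab x (hle hx) y (hle hy)

omit [IsScalarTower F L L] [SMulCommClass F L L] [FiniteDimensional F L] in
theorem span_image_coe_eq {M : NonUnitalSubalgebra F L} {s : Set M}
    (hs : Submodule.span F s = ⊤) :
    Submodule.span F ((fun m : M => (m : L)) '' s) = M.toSubmodule := by
  have h1 := Submodule.map_span M.toSubmodule.subtype s
  have h2 : (Submodule.span F s).map M.toSubmodule.subtype = M.toSubmodule := by
    rw [hs]
    exact (Submodule.map_top _).trans (Submodule.range_subtype _)
  exact h1.symm.trans h2

/-! ### Assembling the classification. -/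

theorem isListed_of_isUniqueMinimalIdeal {A : Submodule F L} (hA : IsUniqueMinimalIdeal F A)
    (hL : IsLeibniz L) (hs : Solvable F L) (hphi : PhiFree F L)
    (hmin : MinimallyNonSupersolvable F L) {M : NonUnitalSubalgebra F L}
    (hc : IsCompl A M.toSubmodule) (hM : ∀ m : M, m * m = 0)
    (hR : ∀ a ∈ A, ∀ v : L, a * v = 0 ∨ a * v = -(v * a)) : IsListed F A := by
  have h := isCriticalRep_leftRep hA hL hs hphi hmin hc hM hR
  have hab := hA.1.mul_eq_zero hL hs
  have hli : ∀ {n : ℕ} {f : Fin n → M}, LinearIndependent F f →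
      LinearIndependent F fun i => (f i : L) := fun hf =>
    hf.map' M.toSubmodule.subtype (Submodule.ker_subtype _)
  refine ⟨hA, fun hss => ?_, fun hss => ?_⟩
  · obtain ⟨x, hx, hspan⟩ := h.exists_span_singleton_eq_top
      (StronglySolvable.mul_eq_zero hA.1.1 hA.1.2.1 h hss)
    have h1 := span_image_coe_eq hspan
    rw [Set.image_singleton] at h1
    exact ⟨h.one_lt_finrank, hab, x, fun h0 => hx (Subtype.ext h0), congrArg Subtype.val (hM x),
      h1 ▸ hc⟩
  · have hMab : ¬ ∀ x y : M, x * y = 0 := fun hMab => hss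
      (stronglySolvable_of_mul_eq_zero hA.1.1 hab hc.sup_eq_top fun x hx y hy =>
        congrArg Subtype.val (hMab ⟨x, hx⟩ ⟨y, hy⟩))
    have : FiniteDimensional F M := inferInstanceAs (FiniteDimensional F M.toSubmodule)
    have hMtop : M ≠ ⊤ := by
      rintro rfl
      exact hA.1.2.1 (by simpa using hc.inf_eq_bot)
    have hval : ∀ {u v : M}, u = v → (u : L) = v := fun h => congrArg Subtype.val h
    rcases h.affine_or_heisenberg hMab (hmin.2 M hMtop) with ⟨x, y, hx, hyx, hspan⟩ |
      ⟨x, y, z, hz, hyx, hzc, hρz⟩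
    · obtain ⟨p, e, x', α, hp, hchar, hyx', hspan', hli', hX, hY, hF⟩ :=
        h.exists_basis_of_affine hMab hx hyx hspan
      have h1 := span_image_coe_eq hspan'
      rw [Set.image_pair] at h1
      have h2 := hli hli'
      refine ⟨p, hp, hchar, Or.inl ⟨e, x', y, α, ?_, h1 ▸ hc, hab, fun i => ?_, fun i => ?_,
        hval hyx', ?_, hval (hM x'), hval (hM y), hF⟩⟩
      · convert h2 using 1
        ext i
        fin_cases i <;> rfl
      · rw [← hX, coe_leftRep_apply]
      · exact congrArg Subtype.val (hY i)
      · refine hval (u := x' * y) (v := -x') ?_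
        rw [h.mul_anticomm, hyx']
    · obtain ⟨p, e, x', y', hp, hchar, hyx', hspan', hli', hX, hY, hF⟩ :=
        h.exists_basis_of_heisenberg hMab hz hyx hzc hρz
      have h1 := span_image_coe_eq hspan'
      rw [Set.image_insert_eq, Set.image_pair] at h1
      have h2 := hli hli'
      have hzc' : ∀ m, z * m = 0 := fun m => by rw [h.mul_anticomm, hzc, neg_zero]
      refine ⟨p, hp, hchar, Or.inr ⟨e, x', y', z, ?_, h1 ▸ hc, hab, fun i => ?_, fun i => ?_,
        fun i => ?_, hval hyx', ?_, hval (hzc x'), hval (hzc' x'), hval (hzc y'), hval (hzc' y'),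
        hval (hM x'), hval (hM y'), hval (hM z), hF⟩⟩
      · convert h2 using 1
        ext i
        fin_cases i <;> rfl
      · rw [← hX, coe_leftRep_apply]
      · exact congrArg Subtype.val (hY i)
      · exact congrArg (fun T : Module.End F A => (T (e i) : L)) hρz
      · refine hval (u := x' * y') (v := -z) ?_
        rw [h.mul_anticomm, hyx']

/-- If `L` is not Lie, the unique minimal ideal is `Leib(L)`. -/
theorem leib_eq_of_isUniqueMinimalIdeal {A : Submodule F L} (hA : IsUniqueMinimalIdeal F A)
    (hL : IsLeibniz L) (hnl : ¬ IsLie L) {M : NonUnitalSubalgebra F L}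
    (hc : IsCompl A M.toSubmodule) : leib F L = A := by
  have hle : ∀ {I : Submodule F L}, IsIdeal F I → I ≠ ⊥ → A ≤ I := fun hI hI0 => by
    obtain ⟨B, hB, hBI⟩ := exists_isMinimalIdeal_le hI hI0
    rwa [hA.2 B hB] at hBI
  have hA_le : A ≤ leib F L := hle (isIdeal_leib hL) fun h => hnl fun a => by
    simpa [h] using mul_self_mem_leib (F := F) a
  -- Left multiplication by `A ≤ Leib(L)` is zero, so the intersection is an ideal of `L`; if
  -- nonzero it would contain `A`, which meets `M` trivially.
  have hK : leib F L ⊓ M.toSubmodule = ⊥ := by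
    by_contra hne
    have hI : IsIdeal F (leib F L ⊓ M.toSubmodule) := by
      intro v k hk
      rw [leib_mul hL hk.1]
      refine ⟨⟨(isIdeal_leib hL v k hk.1).1, ?_⟩, Submodule.zero_mem _⟩
      have hv : v ∈ A ⊔ M.toSubmodule := hc.sup_eq_top ▸ Submodule.mem_top
      obtain ⟨a, ha, m, hm, rfl⟩ := Submodule.mem_sup.1 hv
      rw [add_mul, leib_mul hL (hA_le ha), zero_add]
      exact M.mul_mem hm hk.2
    exact hA.1.2.1 (hc.disjoint.eq_bot_of_le ((hle hI hne).trans inf_le_right))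
  refine le_antisymm (fun v hv => ?_) hA_le
  have hv' : v ∈ A ⊔ M.toSubmodule := hc.sup_eq_top ▸ Submodule.mem_top
  obtain ⟨a, ha, m, hm, rfl⟩ := Submodule.mem_sup.1 hv'
  have h1 : m ∈ leib F L ⊓ M.toSubmodule :=
    ⟨by simpa using Submodule.sub_mem _ hv (hA_le ha), hm⟩
  rw [hK, Submodule.mem_bot] at h1
  rwa [h1, add_zero]

theorem exists_isUniqueMinimalIdeal (hL : IsLeibniz L) (hs : Solvable F L) (hphi : PhiFree F L)
    (hmin : MinimallyNonSupersolvable F L) :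
    ∃ A : Submodule F L, IsUniqueMinimalIdeal F A := by
  have htop : (⊤ : Submodule F L) ≠ ⊥ := fun h => hmin.1
    ⟨0, fun _ => ⊥, rfl, h.symm, fun i hi => ⟨isIdeal_bot, by
      rw [finrank_bot, Nat.le_zero.1 hi]⟩, fun i hi => absurd hi (Nat.not_lt_zero i)⟩
  obtain ⟨A, hA, -⟩ := exists_isMinimalIdeal_le
    (fun _ _ _ => ⟨trivial, trivial⟩ : IsIdeal F (⊤ : Submodule F L)) htop
  exact ⟨A, hA, fun B hB => hA.unique hB hL hs hphi hmin⟩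

end

end LeibnizAlg

theorem mainTheorem2 {F L : Type*} [Field F] [NonUnitalNonAssocRing L] [Module F L]
    [IsScalarTower F L L] [SMulCommClass F L L] [FiniteDimensional F L]
    (hLeibniz : LeibnizAlg.IsLeibniz L)
    (hSolvable : LeibnizAlg.Solvable F L)
    (hPhiFree : LeibnizAlg.PhiFree F L)
    (hMin : LeibnizAlg.MinimallyNonSupersolvable F L) :
    (LeibnizAlg.IsLie L → ∃ A : Submodule F L, LeibnizAlg.IsListed F A) ∧
    (¬ LeibnizAlg.IsLie L →
      ∃ A : Submodule F L, LeibnizAlg.IsListed F A ∧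
        A = LeibnizAlg.leib F L ∧ ∀ a ∈ A, ∀ v : L, a * v = 0) := by
  obtain ⟨A, hA⟩ := LeibnizAlg.exists_isUniqueMinimalIdeal hLeibniz hSolvable hPhiFree hMin
  obtain ⟨M, hc⟩ := LeibnizAlg.exists_isCompl_subalgebra hPhiFree hA.1
    (hA.1.mul_eq_zero hLeibniz hSolvable)
  refine ⟨fun hLie => ⟨A, ?_⟩, fun hnl => ⟨A, ?_⟩⟩
  · refine LeibnizAlg.isListed_of_isUniqueMinimalIdeal hA hLeibniz hSolvable hPhiFree hMin hc
      (fun m => Subtype.ext (hLie m)) fun a _ v => Or.inr ?_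
    have h1 := hLie (a + v)
    rw [add_mul, mul_add, mul_add, hLie a, hLie v, zero_add, add_zero] at h1
    exact eq_neg_of_add_eq_zero_left h1
  · have hleib := LeibnizAlg.leib_eq_of_isUniqueMinimalIdeal hA hLeibniz hnl hc
    have hAL : ∀ a ∈ A, ∀ v : L, a * v = 0 := fun a ha v =>
      LeibnizAlg.leib_mul hLeibniz (F := F) (by rwa [hleib]) v
    refine ⟨LeibnizAlg.isListed_of_isUniqueMinimalIdeal hA hLeibniz hSolvable hPhiFree hMin hc
      (fun m => ?_) fun a ha v => Or.inl (hAL a ha v), hleib.symm, hAL⟩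
    -- The square of `m` lies in `Leib(L) = A` and in `M`.
    refine Subtype.ext (Submodule.disjoint_def.1 hc.disjoint _ ?_ (m * m).2)
    rw [← hleib]
    exact LeibnizAlg.mul_self_mem_leib (m : L)
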